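/- Let the road-side units (RSUs) form a homogeneous Poisson point process $\Phi$ on $\mathbb{R}$ of density $\lambda_{\mathrm r}>0$. Each RSU serves the vehicles (VUs) in its Voronoi cell. The typical RSU is an RSU placed at the origin, i.e. the RSU at $0$ in the configuration $\Phi\cup\{0\}$. The active probability is the probability that the typical RSU serves at least one VU; equivalently it is $1-p_S(0)$, where $p_S(k)$ is the probability that the typical RSU serves exactly $k$ VUs. Put $$f_L(l)=4\lambda_{\mathrm r}^2\,l\,e^{-2\lambda_{\mathrm r}l},\qquad l\ge 0 .$$ (i) Platooned traffic (PTS). Let the VUs form a Matérn cluster process independent of $\Phi$: the parents form a homogeneous Poisson process of density $\lambda_{\mathrm P}>0$, and each parent has, independently, a Poisson number with mean $m>0$ of daughters, placed independently and uniformly in the interval of radius $a>0$ centred at the parent; the VUs are all the daughters. Then the active probability is $$\mathrm p_{\mathrm p}=1-2\int_0^\infty e^{g(0,t)}f_L(2t)\,dt=1-16\lambda_{\mathrm r}^2\int_0^\infty t\,e^{-4\lambda_{\mathrm r}t}\,e^{g(0,t)}\,dt ,$$ where the first integrand is integrable and, with $\bar\beta(t)=\min(t,a)/a$, $$g(s,t)=2\lambda_{\mathrm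 P}\left[|t-a|\,e^{m\bar\beta(t)(s-1)}-(t+a)+\frac{e^{m(s-1)\bar\beta(t)}-1}{(m/(2a))(s-1)}\right].$$ (ii) Traffic without platoons (N-PTS). Let the VUs form a homogeneous Poisson process of density $\lambda>0$ independent of $\Phi$. Then, with $\gamma_{\mathrm r}=\lambda_{\mathrm r}/\lambda$, the active probability is $$\mathrm p_{\mathrm n}=\frac{1+4\gamma_{\mathrm r}}{(1+2\gamma_{\mathrm r})^{2}} .$$ (iii) In the two cases the active RSUs, i.e. the points of $\Phi$ whose Voronoi cell with respect to $\Phi$ contains at least one VU, have density $\mathrm p_{\mathrm p}\lambda_{\mathrm r}$ and $\mathrm p_{\mathrm n}\lambda_{\mathrm r}$, respectively: the mean number of them in any Borel set $B\subseteq\mathbb{R}$ is that density times the length of $B$. -/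

import Mathlib

open MeasureTheory ProbabilityTheory
open scoped ENNReal NNReal

noncomputable section

namespace Highway

/-- The enumerated random points `X 0, X 1, …` form a homogeneous Poisson point process on `ℝ` with
density `lam` under `P`: the number of points in a Borel set of finite length `v` is Poisson
distributed with mean `lam * v`, and the numbers of points in pairwise disjoint such sets are
independent. -/
structure IsPoissonProcess {Ω : Type*} [MeasurableSpace Ω] (P : Measure Ω)
    (X : ℕ → Ω → ℝ) (lam : ℝ) : Prop where
  measurable : ∀ i, Measurable (X i)
  count_law : ∀ B : Set ℝ, MeasurableSet B → volume B ≠ ∞ → ∀ n : ℕ,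
    P {ω | {i | X i ω ∈ B}.encard = (n : ℕ∞)} =
      poissonMeasure (Real.toNNReal (lam * volume.real B)) {n}
  count_indep : ∀ (n : ℕ) (B : Fin n → Set ℝ), (∀ k, MeasurableSet (B k)) →
    (∀ k, volume (B k) ≠ ∞) → Pairwise (fun k l => Disjoint (B k) (B l)) →
    iIndepFun (fun (k : Fin n) (ω : Ω) => {i | X i ω ∈ B k}.encard) P

/-- The data of a one-dimensional Matérn cluster process: parents `X i` form a homogeneous Poisson
point process of density `lamP`; parent `i` has a Poisson number `K i` (mean `m`) of daughters,
displaced from it by `U i j`, `j < K i`, which are uniform on `[-a, a]`; the numbers, the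
displacements and the parents are all independent. -/
structure IsMaternCluster {Ω : Type*} [MeasurableSpace Ω] (P : Measure Ω)
    (X : ℕ → Ω → ℝ) (K : ℕ → Ω → ℕ) (U : ℕ → ℕ → Ω → ℝ) (lamP m a : ℝ) : Prop where
  parents : IsPoissonProcess P X lamP
  measurable_number : ∀ i, Measurable (K i)
  measurable_displacement : ∀ i j, Measurable (U i j)
  number_law : ∀ i, HasLaw (K i) (poissonMeasure (Real.toNNReal m)) P
  displacement_law : ∀ i j, HasLaw (U i j) (cond volume (Set.Icc (-a) a)) P
  number_indep : iIndepFun K P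
  displacement_indep : iIndepFun (fun (p : ℕ × ℕ) => U p.1 p.2) P
  number_indep_displacement :
    IndepFun (fun ω (i : ℕ) => K i ω) (fun ω (i j : ℕ) => U i j ω) P
  parents_indep_daughters :
    IndepFun (fun ω (i : ℕ) => X i ω)
      (fun ω => ((fun i : ℕ => K i ω), (fun i j : ℕ => U i j ω))) P

/-- The points of the cluster process: the union over all parents of their daughters. -/
def clusterPoints {Ω : Type*} (X : ℕ → Ω → ℝ) (K : ℕ → Ω → ℕ) (U : ℕ → ℕ → Ω → ℝ) (ω : Ω) :
    Set ℝ :=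
  {y | ∃ i j : ℕ, j < K i ω ∧ y = X i ω + U i j ω}

/-- The points of an enumerated point process. -/
def points {Ω : Type*} (X : ℕ → Ω → ℝ) (ω : Ω) : Set ℝ :=
  Set.range (fun i => X i ω)

/-- The Voronoi cell of `z` with respect to the configuration `Z`. -/
def voronoiCell (Z : Set ℝ) (z : ℝ) : Set ℝ :=
  {x | ∀ z' ∈ Z \ {z}, |x - z| ≤ |x - z'|}

/-- The load on the RSU at `z`: the number of vehicles in its Voronoi cell, when the RSUs are `Z`
and the vehicles are `Y`. -/
def load (Z Y : Set ℝ) (z : ℝ) : ℕ∞ :=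
  (Y ∩ voronoiCell Z z).encard

/-- The load on the typical RSU: an RSU is placed at the origin, in addition to those of `Z`. -/
def typicalLoad (Z Y : Set ℝ) : ℕ∞ :=
  load (insert 0 Z) Y 0

/-- The active RSUs of the configuration `Z`: those that serve at least one vehicle. -/
def activeRSUs (Z Y : Set ℝ) : Set ℝ :=
  {z ∈ Z | 1 ≤ load Z Y z}

/-- The active probability: the probability that the typical RSU serves at least one vehicle. -/
def activeProb {Ω : Type*} [MeasurableSpace Ω] (P : Measure Ω) (Z Y : Ω → Set ℝ) : ℝ :=
  P.real {ω | 1 ≤ typicalLoad (Z ω) (Y ω)}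

/-- The probability that the load on the typical RSU equals `k`. -/
def loadPMF {Ω : Type*} [MeasurableSpace Ω] (P : Measure Ω) (Z Y : Ω → Set ℝ) (k : ℕ) : ℝ :=
  P.real {ω | typicalLoad (Z ω) (Y ω) = (k : ℕ∞)}

/-- The random set `A` of points has density `d`: the mean number of its points in any Borel set is
`d` times the length of that set. -/
def HasDensity {Ω : Type*} [MeasurableSpace Ω] (P : Measure Ω) (A : Ω → Set ℝ) (d : ℝ) : Prop :=
  ∀ B : Set ℝ, MeasurableSet B →
    ∫⁻ ω, (((A ω ∩ B).encard : ℕ∞) : ℝ≥0∞) ∂P = ENNReal.ofReal d * volume B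

/-- The density of the length of the typical cell. -/
def fL (lamR l : ℝ) : ℝ :=
  4 * lamR ^ 2 * l * Real.exp (-2 * lamR * l)

/-- `min r a / a`, the fraction of a platoon's length covered by a concentric ball of radius
`r`. -/
def betaBar (a r : ℝ) : ℝ :=
  2 * min r a / (2 * a)

/-- The logarithm of the probability generating function at `s` (`s ≠ 1`) of the number of cluster
points in a ball of radius `r`. -/
def g (lamP m a s r : ℝ) : ℝ :=
  2 * lamP * (|r - a| * Real.exp (m * betaBar a r * (s - 1)) - (r + a)
    + (Real.exp (m * (s - 1) * betaBar a r) - 1) / (m / (2 * a) * (s - 1)))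

end Highway

end

/-! The Voronoi cell of an RSU on the line reaches half-way to its two neighbours, so its length is
half the sum `L + R` of the adjacent gaps. The RSU at the origin is inactive exactly when this
interval contains no vehicle. Both traffic models enter only through their void function: the
probability `φ` that an interval is empty of vehicles depends on its length alone
(`IsStationaryTraffic`). Since the vehicles are independent of the RSUs, the inactive probability is
the mean of `φ ((L + R) / 2)`. The gaps at the origin are independent exponentials, hence `L + R`
has density `lam ^ 2 * s * exp (-lam * s)`. This is `activeProb_eq`.

For Poisson vehicles `φ` is an exponential and the integral is a Gamma integral. For the Matérn
process, given the parents, the daughters miss `[p, q]` with probability `exp (-∑ m * coverage)`.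
The Laplace functional of the parents (`lintegral_exp_neg_tsum`) turns this into an integral over
the line, which evaluates to `exp g`.

The density claim needs a Palm statement: summed over the RSUs in `B`, the law of the gap pair is
`lam * volume B` times the law at the origin (`sum_map_gaps`). It comes from the joint tails of the
gaps, which are squeezed between two bounds on a grid whose mesh tends to zero. Each bound uses only
counts in disjoint sets. Conditioning on the RSUs then gives the mean number of inactive RSUs in
`B`, and active ones follow by complement. -/

namespace Highway

open Set Filter Topology

/-! ### Mean and generating function of the Poisson distribution. -/

section PoissonDistribution

lemma lintegral_poissonMeasure (r : ℝ≥0) (F : ℕ → ℝ≥0∞) :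
    ∫⁻ n, F n ∂(poissonMeasure r)
      = ∑' n : ℕ, F n * ENNReal.ofReal (Real.exp (-r) * r ^ n / n.factorial) := by
  rw [lintegral_countable']
  simp_rw [poissonMeasure_singleton]

lemma lintegral_natCast_poissonMeasure (r : ℝ≥0) :
    ∫⁻ n, (n : ℝ≥0∞) ∂(poissonMeasure r) = r := by
  rw [lintegral_poissonMeasure, tsum_eq_zero_add' ENNReal.summable]
  simp only [Nat.cast_zero, zero_mul, zero_add]
  have h (n : ℕ) : ((n + 1 : ℕ) : ℝ≥0∞)
      * ENNReal.ofReal (Real.exp (-r) * r ^ (n + 1) / (n + 1).factorial)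
      = r * ENNReal.ofReal (Real.exp (-r) * r ^ n / n.factorial) := by
    rw [← ENNReal.ofReal_natCast, ← ENNReal.ofReal_mul (by positivity), ← ENNReal.ofReal_coe_nnreal,
      ← ENNReal.ofReal_mul (by positivity), Nat.factorial_succ]
    congr 1
    push_cast
    field_simp
    ring
  simp_rw [h]
  rw [ENNReal.tsum_mul_left, ← ENNReal.ofReal_tsum_of_nonneg (fun n => by positivity)
    (hasSum_one_poissonMeasure r).summable, (hasSum_one_poissonMeasure r).tsum_eq]
  simp

lemma lintegral_pow_poissonMeasure (r : ℝ≥0) {s : ℝ} (hs : 0 ≤ s) :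
    ∫⁻ n, ENNReal.ofReal (s ^ n) ∂(poissonMeasure r) = ENNReal.ofReal (Real.exp (r * (s - 1))) := by
  rw [lintegral_poissonMeasure]
  have h : HasSum (fun n : ℕ => s ^ n * (Real.exp (-r) * r ^ n / n.factorial))
      (Real.exp (r * (s - 1))) := by
    have := (NormedSpace.expSeries_div_hasSum_exp (r * s : ℝ)).mul_left (Real.exp (-r))
    rw [← Real.exp_eq_exp_ℝ, ← Real.exp_add] at this
    rw [show (r : ℝ) * (s - 1) = -r + r * s by ring]
    have e : (fun n : ℕ => s ^ n * (Real.exp (-r) * r ^ n / n.factorial))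
        = fun n : ℕ => Real.exp (-r) * ((r * s : ℝ) ^ n / n.factorial) := by
      funext n
      rw [mul_pow]; ring
    rw [e]
    exact this
  simp_rw [← ENNReal.ofReal_mul (pow_nonneg hs _)]
  rw [← ENNReal.ofReal_tsum_of_nonneg (fun n => by positivity) h.summable, h.tsum_eq]

end PoissonDistribution

/-! ### Counts of a Poisson process in Borel sets. -/

/-- The number of indices whose point lies in `B`. -/
noncomputable def pointCount {Ω : Type*} (X : ℕ → Ω → ℝ) (B : Set ℝ) (ω : Ω) : ℕ∞ := {i | X i ω ∈ B}.encard

lemma toENNReal_encard_eq_tsum {ι : Type*} (s : Set ι) :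
    ((s.encard : ℕ∞) : ℝ≥0∞) = ∑' i, s.indicator (fun _ => 1) i := by
  rw [← ENNReal.tsum_set_one, tsum_subtype s (fun _ => (1 : ℝ≥0∞))]

lemma toENNReal_pointCount {Ω : Type*} (X : ℕ → Ω → ℝ) (B : Set ℝ) (ω : Ω) :
    (pointCount X B ω : ℝ≥0∞) = ∑' i, (X i ⁻¹' B).indicator (fun _ => 1) ω := by
  rw [pointCount, toENNReal_encard_eq_tsum]
  rfl

lemma pointCount_eq_zero {Ω : Type*} {X : ℕ → Ω → ℝ} {B : Set ℝ} {ω : Ω} : pointCount X B ω = 0 ↔ ∀ i, X i ω ∉ B := by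
  simp [pointCount, Set.eq_empty_iff_forall_notMem]

variable {Ω : Type*} [MeasurableSpace Ω] {P : Measure Ω} {X : ℕ → Ω → ℝ} {lam : ℝ}

lemma measurable_pointCount (hX : ∀ i, Measurable (X i)) {B : Set ℝ} (hB : MeasurableSet B) :
    Measurable (pointCount X B) :=
  measurable_encard.comp (measurable_set_iff.2 fun i => measurable_mem.2 (hX i hB))

namespace IsPoissonProcess

variable (hX : IsPoissonProcess P X lam)
include hX

lemma measurable_count {B : Set ℝ} (hB : MeasurableSet B) : Measurable (pointCount X B) :=
  measurable_pointCount hX.measurable hB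

/-- `count_law` speaks only of finite values. Their probabilities already sum to one, so the value
`⊤` has probability zero and the law on `ℕ∞` is determined. -/
lemma map_pointCount [IsProbabilityMeasure P] {B : Set ℝ} (hB : MeasurableSet B)
    (hfin : volume B ≠ ∞) :
    P.map (pointCount X B)
      = (poissonMeasure (Real.toNNReal (lam * volume.real B))).map (Nat.cast : ℕ → ℕ∞) := by
  have hm := hX.measurable_count hB
  have hn (n : ℕ) : P.map (pointCount X B) {(n : ℕ∞)}
      = poissonMeasure (Real.toNNReal (lam * volume.real B)) {n} := by
    rw [Measure.map_apply hm (measurableSet_singleton _)]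
    exact hX.count_law B hB hfin n
  have hn' (n : ℕ) : (poissonMeasure (Real.toNNReal (lam * volume.real B))).map
      (Nat.cast : ℕ → ℕ∞) {(n : ℕ∞)}
      = poissonMeasure (Real.toNNReal (lam * volume.real B)) {n} := by
    rw [Measure.map_apply .of_discrete (measurableSet_singleton _)]
    congr 1; ext; simp
  have : IsProbabilityMeasure (P.map (pointCount X B)) :=
    Measure.isProbabilityMeasure_map hm.aemeasurable
  have hfinite : P.map (pointCount X B) (range (Nat.cast : ℕ → ℕ∞)) = 1 := by
    have : range (Nat.cast : ℕ → ℕ∞) = ⋃ n : ℕ, {(n : ℕ∞)} := by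
      ext; simp
    rw [this, measure_iUnion (fun i j hij => by simpa using hij) (fun _ => .of_discrete)]
    simp_rw [hn]
    rw [← measure_iUnion (fun i j hij => by simpa using hij) (fun _ => .of_discrete)]
    rw [iUnion_of_singleton, measure_univ]
  refine Measure.ext_of_singleton fun k => ?_
  induction k using ENat.recTopCoe with
  | coe n => rw [hn, hn']
  | top =>
    have h1 : P.map (pointCount X B) {(⊤ : ℕ∞)} = 0 := by
      refine measure_mono_null (t := (range (Nat.cast : ℕ → ℕ∞))ᶜ) (by simp) ?_
      exact (prob_compl_eq_zero_iff .of_discrete).2 hfinite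
    rw [h1, Measure.map_apply .of_discrete (measurableSet_singleton _)]
    rw [show (Nat.cast : ℕ → ℕ∞) ⁻¹' {⊤} = ∅ by ext; simp, measure_empty]

lemma lintegral_pointCount [IsProbabilityMeasure P] {B : Set ℝ} (hB : MeasurableSet B)
    (hfin : volume B ≠ ∞) (F : ℕ∞ → ℝ≥0∞) :
    ∫⁻ ω, F (pointCount X B ω) ∂P
      = ∫⁻ n, F n ∂(poissonMeasure (Real.toNNReal (lam * volume.real B))) := by
  rw [← lintegral_map (f := F) .of_discrete (hX.measurable_count hB), hX.map_pointCount hB hfin,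
    lintegral_map .of_discrete .of_discrete]

lemma measure_pointCount_eq_natCast (hlam : 0 ≤ lam) {B : Set ℝ} (hB : MeasurableSet B)
    (hfin : volume B ≠ ∞) (n : ℕ) :
    P {ω | pointCount X B ω = n} = ENNReal.ofReal
      (Real.exp (-(lam * volume.real B)) * (lam * volume.real B) ^ n / n.factorial) := by
  have := hX.count_law B hB hfin n
  rw [poissonMeasure_singleton, Real.coe_toNNReal _ (mul_nonneg hlam measureReal_nonneg)] at this
  exact this

lemma measure_void (hlam : 0 ≤ lam) {B : Set ℝ} (hB : MeasurableSet B) (hfin : volume B ≠ ∞) :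
    P {ω | ∀ i, X i ω ∉ B} = ENNReal.ofReal (Real.exp (-(lam * volume.real B))) := by
  have := hX.measure_pointCount_eq_natCast hlam hB hfin 0
  simpa [pointCount_eq_zero] using this

lemma ae_pointCount_ne_top [IsProbabilityMeasure P] {B : Set ℝ} (hB : MeasurableSet B)
    (hfin : volume B ≠ ∞) : ∀ᵐ ω ∂P, pointCount X B ω ≠ ⊤ := by
  have h : ∀ᵐ k ∂(P.map (pointCount X B)), k ≠ ⊤ := by
    rw [hX.map_pointCount hB hfin, ae_map_iff .of_discrete .of_discrete]
    simp
  exact ae_of_ae_map (hX.measurable_count hB).aemeasurable h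

lemma lintegral_toENNReal_pointCount [IsProbabilityMeasure P] {B : Set ℝ} (hB : MeasurableSet B)
    (hfin : volume B ≠ ∞) :
    ∫⁻ ω, (pointCount X B ω : ℝ≥0∞) ∂P = ENNReal.ofReal lam * volume B := by
  rw [hX.lintegral_pointCount hB hfin (fun n => (n : ℝ≥0∞))]
  simp only [ENat.toENNReal_coe]
  rw [lintegral_natCast_poissonMeasure, ← ENNReal.ofReal,
    ENNReal.ofReal_mul' measureReal_nonneg, ofReal_measureReal hfin]

lemma tsum_measure_preimage [IsProbabilityMeasure P] {B : Set ℝ} (hB : MeasurableSet B)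
    (hfin : volume B ≠ ∞) : ∑' i, P (X i ⁻¹' B) = ENNReal.ofReal lam * volume B := by
  rw [← hX.lintegral_toENNReal_pointCount hB hfin]
  simp_rw [toENNReal_pointCount]
  rw [lintegral_tsum fun i => (measurable_const.indicator (hX.measurable i hB)).aemeasurable]
  exact tsum_congr fun i => (lintegral_indicator_one (hX.measurable i hB)).symm

/-- The probability generating function of the counts in disjoint sets. -/
lemma lintegral_prod_pow_pointCount (hlam : 0 ≤ lam) [IsProbabilityMeasure P] {n : ℕ}
    {B : Fin n → Set ℝ} (hB : ∀ k, MeasurableSet (B k)) (hfin : ∀ k, volume (B k) ≠ ∞)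
    (hdisj : Pairwise (fun k l => Disjoint (B k) (B l))) {s : Fin n → ℝ} (hs : ∀ k, 0 ≤ s k) :
    ∫⁻ ω, ∏ k, ENNReal.ofReal (s k ^ (pointCount X (B k) ω).toNat) ∂P
      = ENNReal.ofReal (Real.exp (-(lam * ∑ k, (1 - s k) * volume.real (B k)))) := by
  have hind := (hX.count_indep n B hB hfin hdisj).comp
    (fun k (N : ℕ∞) => ENNReal.ofReal (s k ^ N.toNat)) (fun _ => .of_discrete)
  have := lintegral_prod_eq_prod_lintegral_of_indepFun Finset.univ _ hind
    (fun k => Measurable.of_discrete.comp (hX.measurable_count (hB k)))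
  simp only [Function.comp_def] at this
  refine this.trans ?_
  have h (k : Fin n) : ∫⁻ ω, ENNReal.ofReal (s k ^ (pointCount X (B k) ω).toNat) ∂P
      = ENNReal.ofReal (Real.exp (-(lam * ((1 - s k) * volume.real (B k))))) := by
    rw [hX.lintegral_pointCount (hB k) (hfin k) (fun N => ENNReal.ofReal (s k ^ N.toNat))]
    simp only [ENat.toNat_natCast]
    rw [lintegral_pow_poissonMeasure _ (hs k),
      Real.coe_toNNReal _ (mul_nonneg hlam measureReal_nonneg)]
    congr 2; ring
  calc _ = ∏ k, ENNReal.ofReal (Real.exp (-(lam * ((1 - s k) * volume.real (B k))))) :=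
        Finset.prod_congr rfl fun k _ => h k
    _ = _ := by
      rw [← ENNReal.ofReal_prod_of_nonneg (fun _ _ => (Real.exp_pos _).le), ← Real.exp_sum,
        Finset.sum_neg_distrib, Finset.mul_sum]

lemma indepFun_pointCount {B C : Set ℝ} (hB : MeasurableSet B) (hC : MeasurableSet C)
    (hBfin : volume B ≠ ∞) (hCfin : volume C ≠ ∞) (hdisj : Disjoint B C) :
    IndepFun (pointCount X B) (pointCount X C) P := by
  have := hX.count_indep 2 ![B, C] (by simp [Fin.forall_fin_two, hB, hC])
    (by simp [Fin.forall_fin_two, hBfin, hCfin])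
    (by
      intro k l hkl
      fin_cases k <;> fin_cases l <;> simp_all [disjoint_comm])
  exact this.indepFun (i := 0) (j := 1) (by simp)

end IsPoissonProcess

/-! ### Nearest-neighbour gaps and the grid. -/

/-- The distance from `z` to the next point to its right. -/
noncomputable def rightGap (ζ : ℕ → ℝ) (z : ℝ) : ℝ≥0∞ :=
  ⨅ j, if z < ζ j then ENNReal.ofReal (ζ j - z) else ∞

/-- The distance from `z` to the next point to its left. -/
noncomputable def leftGap (ζ : ℕ → ℝ) (z : ℝ) : ℝ≥0∞ :=
  ⨅ j, if ζ j < z then ENNReal.ofReal (z - ζ j) else ∞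

lemma measurable_rightGap : Measurable (fun p : (ℕ → ℝ) × ℝ => rightGap p.1 p.2) := by
  refine Measurable.iInf fun j => Measurable.ite ?_ (by fun_prop) measurable_const
  exact measurableSet_lt measurable_snd (by fun_prop)

lemma measurable_leftGap : Measurable (fun p : (ℕ → ℝ) × ℝ => leftGap p.1 p.2) := by
  refine Measurable.iInf fun j => Measurable.ite ?_ (by fun_prop) measurable_const
  exact measurableSet_lt (by fun_prop) measurable_snd

lemma ofReal_le_rightGap {ζ : ℕ → ℝ} {z v : ℝ} :
    ENNReal.ofReal v ≤ rightGap ζ z ↔ ∀ j, z < ζ j → v ≤ ζ j - z := by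
  rw [rightGap, le_iInf_iff]
  refine forall_congr' fun j => ?_
  split_ifs with h
  · simp [h, ENNReal.ofReal_le_ofReal_iff (sub_nonneg.2 h.le)]
  · simp [h]

lemma ofReal_le_leftGap {ζ : ℕ → ℝ} {z v : ℝ} :
    ENNReal.ofReal v ≤ leftGap ζ z ↔ ∀ j, ζ j < z → v ≤ z - ζ j := by
  rw [leftGap, le_iInf_iff]
  refine forall_congr' fun j => ?_
  split_ifs with h
  · simp [h, ENNReal.ofReal_le_ofReal_iff (sub_nonneg.2 h.le)]
  · simp [h]

lemma rightGap_ne_top {ζ : ℕ → ℝ} {z : ℝ} {j : ℕ} (h : z < ζ j) : rightGap ζ z ≠ ∞ := by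
  refine ne_top_of_le_ne_top (b := ENNReal.ofReal (ζ j - z)) ENNReal.ofReal_ne_top ?_
  exact (iInf_le _ j).trans (by simp [h])

lemma leftGap_ne_top {ζ : ℕ → ℝ} {z : ℝ} {j : ℕ} (h : ζ j < z) : leftGap ζ z ≠ ∞ := by
  refine ne_top_of_le_ne_top (b := ENNReal.ofReal (z - ζ j)) ENNReal.ofReal_ne_top ?_
  exact (iInf_le _ j).trans (by simp [h])

/-- The cells of the grid of mesh `δ`. -/
def gridCell (δ : ℝ) (k : ℤ) : Set ℝ := Ico (k • δ) ((k + 1) • δ)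

lemma measurableSet_gridCell (δ : ℝ) (k : ℤ) : MeasurableSet (gridCell δ k) := measurableSet_Ico

lemma measure_eq_tsum_gridCell {Ω : Type*} [MeasurableSpace Ω] (P : Measure Ω) {f : Ω → ℝ}
    (hf : Measurable f) {A : Set Ω} (hA : MeasurableSet A) {δ : ℝ} (hδ : 0 < δ) :
    P A = ∑' k : ℤ, P (A ∩ f ⁻¹' gridCell δ k) := by
  rw [← measure_iUnion]
  · rw [← inter_iUnion, ← preimage_iUnion]
    simp only [gridCell, iUnion_Ico_zsmul hδ, preimage_univ, inter_univ]
  · intro k l hkl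
    exact ((pairwise_disjoint_Ico_zsmul δ hkl).preimage f).mono inter_subset_right
      inter_subset_right
  · exact fun k => hA.inter (hf (measurableSet_gridCell δ k))

lemma volume_eq_tsum_gridCell {B : Set ℝ} (hB : MeasurableSet B) {δ : ℝ} (hδ : 0 < δ) :
    volume B = ∑' k : ℤ, volume (B ∩ gridCell δ k) :=
  measure_eq_tsum_gridCell volume measurable_id hB hδ

/-! ### Joint tails of the gaps; simplicity and unboundedness of the process. -/

namespace IsPoissonProcess

variable {Ω : Type*} [MeasurableSpace Ω] {P : Measure Ω}
  {Z : ℕ → Ω → ℝ} {lam : ℝ}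

lemma measurableSet_gaps (hZ : ∀ i, Measurable (Z i)) {f : Ω → ℝ} (hf : Measurable f)
    (a b : ℝ≥0∞) :
    MeasurableSet {ω | a ≤ leftGap (fun j => Z j ω) (f ω) ∧ b ≤ rightGap (fun j => Z j ω) (f ω)} :=
  (measurableSet_le measurable_const
    (measurable_leftGap.comp ((measurable_pi_lambda _ hZ).prodMk hf))).inter
  (measurableSet_le measurable_const
    (measurable_rightGap.comp ((measurable_pi_lambda _ hZ).prodMk hf)))

variable (hZ : IsPoissonProcess P Z lam)
include hZ

/-- A point of the cell `J` with large gaps forces a slightly shrunken neighbourhood `C` of the cell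
to be empty. The sum is thus at most the mean of `N(J)` times the indicator of `N(C) = 0`, and this
factors because `J` and `C` are disjoint. -/
lemma tsum_measure_gaps_gridCell_le [IsProbabilityMeasure P] (hlam : 0 < lam) {B : Set ℝ} (hB : MeasurableSet B)
    (hfin : volume B ≠ ∞) (u v : ℝ) {δ : ℝ} (hδ : 0 ≤ δ) (k : ℤ) :
    ∑' i, P ((Z i ⁻¹' B ∩ {ω | ENNReal.ofReal u ≤ leftGap (fun j => Z j ω) (Z i ω) ∧
        ENNReal.ofReal v ≤ rightGap (fun j => Z j ω) (Z i ω)}) ∩ Z i ⁻¹' gridCell δ k)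
      ≤ ENNReal.ofReal lam * volume (B ∩ gridCell δ k)
        * ENNReal.ofReal (Real.exp (-(lam * (u + v - 2 * δ)))) := by
  set J := B ∩ gridCell δ k with hJ
  have hJm : MeasurableSet J := hB.inter (measurableSet_gridCell δ k)
  have hJfin : volume J ≠ ∞ := measure_ne_top_of_subset inter_subset_left hfin
  set p := k • δ with hp
  have hp' : (k + 1) • δ = p + δ := by rw [hp, add_smul, one_smul]
  -- Each endpoint is taken for the worst position in `[p, p + δ)`: a point of `C` lies within `u`
  -- to the left, or within `v` to the right, of every point of the cell.
  set C := Ioo (p + δ - u) p ∪ Ioo (p + δ) (p + v) with hC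
  have hCm : MeasurableSet C := measurableSet_Ioo.union measurableSet_Ioo
  have hCfin : volume C ≠ ∞ := by
    refine ne_top_of_le_ne_top ?_ (measure_union_le _ _)
    simp
  have hJmem {x : ℝ} (hx : x ∈ J) : p ≤ x ∧ x < p + δ := by
    have := hx.2
    rw [gridCell, hp'] at this
    exact this
  have hmain (i : ℕ) : P ((Z i ⁻¹' B ∩ {ω | ENNReal.ofReal u ≤ leftGap (fun j => Z j ω) (Z i ω) ∧
        ENNReal.ofReal v ≤ rightGap (fun j => Z j ω) (Z i ω)}) ∩ Z i ⁻¹' gridCell δ k)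
      ≤ ∫⁻ ω, (Z i ⁻¹' J).indicator (fun _ => 1) ω
          * (if pointCount Z C ω = 0 then 1 else 0) ∂P := by
    rw [← lintegral_indicator_one₀]
    · refine lintegral_mono fun ω => ?_
      by_cases hω : ω ∈ (Z i ⁻¹' B ∩ {ω | ENNReal.ofReal u ≤ leftGap (fun j => Z j ω) (Z i ω) ∧
        ENNReal.ofReal v ≤ rightGap (fun j => Z j ω) (Z i ω)}) ∩ Z i ⁻¹' gridCell δ k
      · rw [indicator_of_mem hω]
        have hiJ : Z i ω ∈ J := ⟨hω.1.1, hω.2⟩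
        have hl := ofReal_le_leftGap.1 hω.1.2.1
        have hr := ofReal_le_rightGap.1 hω.1.2.2
        obtain ⟨h1, h2⟩ := hJmem hiJ
        rw [indicator_of_mem (show ω ∈ Z i ⁻¹' J from hiJ), if_pos]
        · simp
        · rw [pointCount_eq_zero]
          rintro j (⟨h3, h4⟩ | ⟨h3, h4⟩)
          · have := hl j (by linarith)
            linarith
          · have := hr j (by linarith)
            linarith
      · rw [indicator_of_notMem hω]
        exact zero_le
    · exact (((hZ.measurable i hB).inter (measurableSet_gaps hZ.measurable (hZ.measurable i) _ _)).inter
        (hZ.measurable i (measurableSet_gridCell δ k))).nullMeasurableSet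
  have hcm : Measurable fun ω => (if pointCount Z C ω = 0 then 1 else 0 : ℝ≥0∞) :=
    (Measurable.of_discrete (f := fun n : ℕ∞ => (if n = 0 then 1 else 0 : ℝ≥0∞))).comp
      (hZ.measurable_count hCm)
  have hdisj : Disjoint J C := by
    rw [Set.disjoint_left]
    rintro x hx (⟨h3, h4⟩ | ⟨h3, h4⟩) <;> have := hJmem hx <;> linarith
  calc _ ≤ ∑' i, ∫⁻ ω, (Z i ⁻¹' J).indicator (fun _ => 1) ω
          * (if pointCount Z C ω = 0 then 1 else 0) ∂P := ENNReal.tsum_le_tsum hmain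
    _ = ∫⁻ ω, (pointCount Z J ω : ℝ≥0∞) * (if pointCount Z C ω = 0 then 1 else 0) ∂P := by
      rw [← lintegral_tsum]
      · simp_rw [ENNReal.tsum_mul_right, ← toENNReal_pointCount]
      · exact fun i => ((measurable_const.indicator (hZ.measurable i hJm)).mul hcm).aemeasurable
    _ = (∫⁻ ω, (pointCount Z J ω : ℝ≥0∞) ∂P)
          * ∫⁻ ω, (if pointCount Z C ω = 0 then 1 else 0) ∂P := by
      refine lintegral_mul_eq_lintegral_mul_lintegral_of_indepFun
        (Measurable.of_discrete.comp (hZ.measurable_count hJm)) hcm ?_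
      exact (hZ.indepFun_pointCount hJm hCm hJfin hCfin hdisj).comp
        (φ := fun n : ℕ∞ => (n : ℝ≥0∞)) (ψ := fun n : ℕ∞ => (if n = 0 then 1 else 0 : ℝ≥0∞))
        .of_discrete .of_discrete
    _ ≤ _ := by
      rw [hZ.lintegral_toENNReal_pointCount hJm hJfin]
      gcongr
      have : ∫⁻ ω, (if pointCount Z C ω = 0 then 1 else 0) ∂P
          = P {ω | ∀ i, Z i ω ∉ C} := by
        have hm : MeasurableSet {ω | ∀ i, Z i ω ∉ C} := by
          simp_rw [← pointCount_eq_zero (X := Z)]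
          exact hZ.measurable_count hCm (measurableSet_singleton 0)
        rw [← lintegral_indicator_one hm]
        refine lintegral_congr fun ω => ?_
        by_cases h : ∀ i, Z i ω ∉ C
        · rw [if_pos (pointCount_eq_zero.2 h)]
          exact (indicator_of_mem (s := {ω | ∀ i, Z i ω ∉ C}) h (1 : Ω → ℝ≥0∞)).symm
        · rw [if_neg (fun h' => h (pointCount_eq_zero.1 h'))]
          exact (indicator_of_notMem (s := {ω | ∀ i, Z i ω ∉ C}) h (1 : Ω → ℝ≥0∞)).symm
      rw [this, hZ.measure_void hlam.le hCm hCfin]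
      refine ENNReal.ofReal_le_ofReal (Real.exp_le_exp.2 (neg_le_neg ?_))
      refine mul_le_mul_of_nonneg_left ?_ hlam.le
      rw [hC, measureReal_union _ measurableSet_Ioo (by simp) (by simp)]
      · rw [Real.volume_real_Ioo, Real.volume_real_Ioo]
        -- An interval of `C` may be empty, with length truncated at zero; the lower bound `u + v -
        -- 2 * δ` on the total length holds regardless.
        have h1 := le_max_left (p - (p + δ - u)) 0
        have h2 := le_max_left (p + v - (p + δ)) 0
        linarith
      · rw [Set.disjoint_left]
        rintro x ⟨h3, h4⟩ ⟨h5, h6⟩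
        linarith

/-- If `J` holds exactly one point and the rest `D` of the enlarged window holds none, then that
point is isolated. The probability of this event is exactly the left side: the void factors of `J`
and `D` multiply to that of a window of length `u + v + δ`. -/
lemma le_tsum_measure_isolated_gridCell (hlam : 0 < lam) {B : Set ℝ} (hB : MeasurableSet B)
    (hfin : volume B ≠ ∞) {u v : ℝ} (hu : 0 ≤ u) (hv : 0 ≤ v) {δ : ℝ} (hδ : 0 ≤ δ) (k : ℤ) :
    ENNReal.ofReal lam * volume (B ∩ gridCell δ k)
        * ENNReal.ofReal (Real.exp (-(lam * (u + v + δ))))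
      ≤ ∑' i, P ((Z i ⁻¹' B ∩ {ω | ∀ j, j ≠ i → Z j ω ∉ Icc (Z i ω - u) (Z i ω + v)})
          ∩ Z i ⁻¹' gridCell δ k) := by
  set J := B ∩ gridCell δ k with hJ
  have hJm : MeasurableSet J := hB.inter (measurableSet_gridCell δ k)
  have hJfin : volume J ≠ ∞ := measure_ne_top_of_subset inter_subset_left hfin
  set p := k • δ with hp
  have hp' : (k + 1) • δ = p + δ := by rw [hp, add_smul, one_smul]
  have hJmem {x : ℝ} (hx : x ∈ J) : p ≤ x ∧ x < p + δ := by
    have := hx.2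
    rw [gridCell, hp'] at this
    exact this
  set D := Icc (p - u) (p + δ + v) \ J with hD
  have hDm : MeasurableSet D := measurableSet_Icc.diff hJm
  have hDfin : volume D ≠ ∞ := measure_ne_top_of_subset sdiff_subset (by simp)
  have hdisj : Disjoint J D := disjoint_sdiff_right
  have hvol : volume.real J + volume.real D = u + v + δ := by
    rw [← measureReal_union hdisj hDm, hD, union_sdiff_cancel]
    · rw [Real.volume_real_Icc_of_le (by linarith)]; ring
    · intro x hx
      have := hJmem hx
      exact ⟨by linarith, by linarith⟩
  have hprob : P (pointCount Z J ⁻¹' {1} ∩ pointCount Z D ⁻¹' {0})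
      = ENNReal.ofReal lam * volume J * ENNReal.ofReal (Real.exp (-(lam * (u + v + δ)))) := by
    rw [(hZ.indepFun_pointCount hJm hDm hJfin hDfin hdisj).measure_inter_preimage_eq_mul _ _
      .of_discrete .of_discrete]
    have h1 := hZ.measure_pointCount_eq_natCast hlam.le hJm hJfin 1
    have h0 := hZ.measure_pointCount_eq_natCast hlam.le hDm hDfin 0
    have e1 : pointCount Z J ⁻¹' {1} = {ω | pointCount Z J ω = ((1 : ℕ) : ℕ∞)} := by ext; simp
    have e0 : pointCount Z D ⁻¹' {0} = {ω | pointCount Z D ω = ((0 : ℕ) : ℕ∞)} := by ext; simp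
    rw [e1, e0, h1, h0, ← ENNReal.ofReal_mul (by positivity), ← ofReal_measureReal hJfin,
      ← ENNReal.ofReal_mul hlam.le, ← ENNReal.ofReal_mul (by positivity)]
    congr 1
    simp only [pow_one, Nat.factorial_one, Nat.cast_one, div_one, pow_zero, Nat.factorial_zero,
      mul_one]
    rw [← hvol, mul_add, neg_add, Real.exp_add]
    ring
  rw [← hprob]
  refine (measure_mono ?_).trans (measure_iUnion_le _)
  rintro ω ⟨h1, h0⟩
  obtain ⟨i, hi⟩ := encard_eq_one.1 (show {i | Z i ω ∈ J}.encard = 1 from h1)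
  have h0' := pointCount_eq_zero.1 (show pointCount Z D ω = 0 from h0)
  have hiJ : Z i ω ∈ J := by
    have : i ∈ {i | Z i ω ∈ J} := by rw [hi]; rfl
    exact this
  refine mem_iUnion.2 ⟨i, ⟨hiJ.1, fun j hj hmem => ?_⟩, hiJ.2⟩
  have hjJ : Z j ω ∉ J := fun hjJ => by
    have : j ∈ {i | Z i ω ∈ J} := hjJ
    rw [hi] at this
    exact hj this
  obtain ⟨h2, h3⟩ := hJmem hiJ
  exact h0' j ⟨⟨by linarith [hmem.1], by linarith [hmem.2]⟩, hjJ⟩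

lemma measurableSet_isolated (i : ℕ) (u v : ℝ) :
    MeasurableSet {ω | ∀ j, j ≠ i → Z j ω ∉ Icc (Z i ω - u) (Z i ω + v)} := by
  have hm := hZ.measurable
  simp only [ofPred_forall]
  refine MeasurableSet.iInter fun j => MeasurableSet.iInter fun _ => ?_
  exact ((measurableSet_le ((hm i).sub_const u) (hm j)).inter
    (measurableSet_le (hm j) ((hm i).add_const v))).compl

/-- The excluded interval is closed and contains the point itself, and the exclusion is by index.
The event is therefore meaningful at `u = v = 0`, where it says that no other index has the same
position; `ae_injective` uses this case. -/
lemma le_tsum_measure_isolated (hlam : 0 < lam) {B : Set ℝ} (hB : MeasurableSet B)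
    (hfin : volume B ≠ ∞) {u v : ℝ} (hu : 0 ≤ u) (hv : 0 ≤ v) :
    ENNReal.ofReal lam * volume B * ENNReal.ofReal (Real.exp (-(lam * (u + v))))
      ≤ ∑' i, P (Z i ⁻¹' B ∩ {ω | ∀ j, j ≠ i → Z j ω ∉ Icc (Z i ω - u) (Z i ω + v)}) := by
  have hlim : Tendsto (fun δ : ℝ => ENNReal.ofReal lam * volume B
      * ENNReal.ofReal (Real.exp (-(lam * (u + v + δ))))) (𝓝[>] 0)
      (𝓝 (ENNReal.ofReal lam * volume B * ENNReal.ofReal (Real.exp (-(lam * (u + v + 0)))))) := by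
    refine ENNReal.Tendsto.const_mul ?_ (.inr (ENNReal.mul_ne_top ENNReal.ofReal_ne_top hfin))
    refine ENNReal.tendsto_ofReal (Tendsto.mono_left ?_ nhdsWithin_le_nhds)
    exact Continuous.tendsto (by fun_prop) 0
  rw [add_zero] at hlim
  refine le_of_tendsto hlim (eventually_mem_nhdsWithin.mono fun δ (hδ : 0 < δ) => ?_)
  have hA (i : ℕ) := (hZ.measurable i hB).inter (hZ.measurableSet_isolated i u v)
  calc _ = ∑' k : ℤ, ENNReal.ofReal lam * volume (B ∩ gridCell δ k)
        * ENNReal.ofReal (Real.exp (-(lam * (u + v + δ)))) := by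
        rw [ENNReal.tsum_mul_right, ENNReal.tsum_mul_left, ← volume_eq_tsum_gridCell hB hδ]
    _ ≤ _ := ENNReal.tsum_le_tsum fun k =>
        hZ.le_tsum_measure_isolated_gridCell hlam hB hfin hu hv hδ.le k
    _ = _ := by
        rw [ENNReal.tsum_comm]
        exact tsum_congr fun i =>
          (measure_eq_tsum_gridCell P (hZ.measurable i) (hA i) hδ).symm

lemma tsum_measure_gaps_le [IsProbabilityMeasure P] (hlam : 0 < lam) {B : Set ℝ} (hB : MeasurableSet B)
    (hfin : volume B ≠ ∞) (u v : ℝ) :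
    ∑' i, P (Z i ⁻¹' B ∩ {ω | ENNReal.ofReal u ≤ leftGap (fun j => Z j ω) (Z i ω) ∧
        ENNReal.ofReal v ≤ rightGap (fun j => Z j ω) (Z i ω)})
      ≤ ENNReal.ofReal lam * volume B * ENNReal.ofReal (Real.exp (-(lam * (u + v)))) := by
  have hlim : Tendsto (fun δ : ℝ => ENNReal.ofReal lam * volume B
      * ENNReal.ofReal (Real.exp (-(lam * (u + v - 2 * δ))))) (𝓝[>] 0)
      (𝓝 (ENNReal.ofReal lam * volume B
        * ENNReal.ofReal (Real.exp (-(lam * (u + v - 2 * 0)))))) := by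
    refine ENNReal.Tendsto.const_mul ?_ (.inr (ENNReal.mul_ne_top ENNReal.ofReal_ne_top hfin))
    refine ENNReal.tendsto_ofReal (Tendsto.mono_left ?_ nhdsWithin_le_nhds)
    exact Continuous.tendsto (by fun_prop) 0
  rw [mul_zero, sub_zero] at hlim
  refine ge_of_tendsto hlim (eventually_mem_nhdsWithin.mono fun δ (hδ : 0 < δ) => ?_)
  have hA (i : ℕ) := (hZ.measurable i hB).inter
    (measurableSet_gaps hZ.measurable (hZ.measurable i) (ENNReal.ofReal u) (ENNReal.ofReal v))
  calc _ = ∑' k : ℤ, ∑' i, P ((Z i ⁻¹' B ∩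
        {ω | ENNReal.ofReal u ≤ leftGap (fun j => Z j ω) (Z i ω) ∧
        ENNReal.ofReal v ≤ rightGap (fun j => Z j ω) (Z i ω)}) ∩ Z i ⁻¹' gridCell δ k) := by
        rw [ENNReal.tsum_comm]
        exact tsum_congr fun i => measure_eq_tsum_gridCell P (hZ.measurable i) (hA i) hδ
    _ ≤ ∑' k : ℤ, ENNReal.ofReal lam * volume (B ∩ gridCell δ k)
        * ENNReal.ofReal (Real.exp (-(lam * (u + v - 2 * δ)))) :=
        ENNReal.tsum_le_tsum fun k =>
          hZ.tsum_measure_gaps_gridCell_le hlam hB hfin u v hδ.le k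
    _ = _ := by
        rw [ENNReal.tsum_mul_right, ENNReal.tsum_mul_left, ← volume_eq_tsum_gridCell hB hδ]

/-- The joint tail of the two gaps at the points of a Poisson process. -/
lemma tsum_measure_gaps [IsProbabilityMeasure P] (hlam : 0 < lam) {B : Set ℝ} (hB : MeasurableSet B)
    (hfin : volume B ≠ ∞) {u v : ℝ} (hu : 0 ≤ u) (hv : 0 ≤ v) :
    ∑' i, P (Z i ⁻¹' B ∩ {ω | ENNReal.ofReal u ≤ leftGap (fun j => Z j ω) (Z i ω) ∧
        ENNReal.ofReal v ≤ rightGap (fun j => Z j ω) (Z i ω)})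
      = ENNReal.ofReal lam * volume B * ENNReal.ofReal (Real.exp (-(lam * (u + v)))) := by
  -- Isolation implies large gaps, so the lower bound for isolated points closes the squeeze.
  refine le_antisymm (hZ.tsum_measure_gaps_le hlam hB hfin u v)
    ((hZ.le_tsum_measure_isolated hlam hB hfin hu hv).trans ?_)
  refine ENNReal.tsum_le_tsum fun i => measure_mono (inter_subset_inter_right _ fun ω hω => ?_)
  refine ⟨ofReal_le_leftGap.2 fun j hj => ?_, ofReal_le_rightGap.2 fun j hj => ?_⟩
  · by_contra! h
    exact hω j (fun hji => by simp [hji] at hj) ⟨by linarith, by linarith⟩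
  · by_contra! h
    exact hω j (fun hji => by simp [hji] at hj) ⟨by linarith, by linarith⟩

/-- Almost surely the points of a Poisson process are distinct. -/
lemma ae_injective [IsProbabilityMeasure P] (hlam : 0 < lam) : ∀ᵐ ω ∂P, Function.Injective (fun i => Z i ω) := by
  have key (n : ℕ) (i : ℕ) : ∀ᵐ ω ∂P, Z i ω ∈ Icc (-(n : ℝ)) n → ∀ j, j ≠ i → Z j ω ≠ Z i ω := by
    set B := Icc (-(n : ℝ)) n
    have hB : MeasurableSet B := measurableSet_Icc
    have hfin : volume B ≠ ∞ := by simp [B]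
    -- With `u = v = 0` the bound equals the full intensity of `B`, which is finite, so nothing is
    -- left for indices sharing their position with another.
    have hle := hZ.le_tsum_measure_isolated hlam hB hfin le_rfl le_rfl
    have htot := hZ.tsum_measure_preimage hB hfin
    simp only [add_zero, mul_zero, neg_zero, Real.exp_zero, ENNReal.ofReal_one, mul_one,
      sub_zero, Icc_self, mem_singleton_iff] at hle
    rw [← htot] at hle
    set A : ℕ → Set Ω := fun i => {ω | ∀ j, j ≠ i → ¬ Z j ω = Z i ω} with hAdef
    have hAm (i : ℕ) : MeasurableSet (A i) := by
      simpa [hAdef] using hZ.measurableSet_isolated i 0 0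
    have hsum : ∑' i, P (Z i ⁻¹' B) = ∑' i, P (Z i ⁻¹' B ∩ A i) + ∑' i, P (Z i ⁻¹' B \ A i) := by
      rw [← ENNReal.tsum_add]
      exact tsum_congr fun i => (measure_inter_add_sdiff _ (hAm i)).symm
    have hne : ∑' i, P (Z i ⁻¹' B) ≠ ∞ := by
      rw [htot]; exact ENNReal.mul_ne_top ENNReal.ofReal_ne_top hfin
    have hzero : ∑' i, P (Z i ⁻¹' B \ A i) = 0 := by
      have hne' : ∑' i, P (Z i ⁻¹' B ∩ A i) ≠ ∞ :=
        ne_top_of_le_ne_top hne (ENNReal.tsum_le_tsum fun i => measure_mono inter_subset_left)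
      have h2 := hsum ▸ hle
      by_contra h0
      exact absurd h2 (not_le.2 (ENNReal.lt_add_right hne' h0))
    have := ENNReal.tsum_eq_zero.1 hzero i
    rw [ae_iff]
    refine measure_mono_null (fun ω hω => ?_) this
    simp only [mem_ofPred_eq, Classical.not_imp] at hω
    exact hω
  have hall : ∀ᵐ ω ∂P, ∀ n i : ℕ, Z i ω ∈ Icc (-(n : ℝ)) n → ∀ j, j ≠ i → Z j ω ≠ Z i ω :=
    ae_all_iff.2 fun n => ae_all_iff.2 fun i => key n i
  filter_upwards [hall] with ω hω i j hij
  by_contra hne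
  obtain ⟨n, hn⟩ := exists_nat_ge |Z j ω|
  exact hω n j (abs_le.1 hn) i hne hij

lemma measure_gaps_zero (hlam : 0 < lam) {u v : ℝ} (hu : 0 ≤ u) (hv : 0 ≤ v) :
    P {ω | ENNReal.ofReal u ≤ leftGap (fun j => Z j ω) 0 ∧
        ENNReal.ofReal v ≤ rightGap (fun j => Z j ω) 0}
      = ENNReal.ofReal (Real.exp (-(lam * (u + v)))) := by
  have hset : {ω | ENNReal.ofReal u ≤ leftGap (fun j => Z j ω) 0 ∧
        ENNReal.ofReal v ≤ rightGap (fun j => Z j ω) 0}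
      = {ω | ∀ i, Z i ω ∉ Ioo (-u) 0 ∪ Ioo 0 v} := by
    ext ω
    simp only [mem_ofPred_eq, ofReal_le_leftGap, ofReal_le_rightGap, mem_union, mem_Ioo, not_or,
      not_and, not_lt, forall_and, zero_sub, sub_zero]
    refine and_congr (forall_congr' fun i => ?_) (forall_congr' fun i => ?_)
    · constructor <;> intro h h' <;> by_contra! h'' <;> linarith [h (by linarith)]
    · rfl
  rw [hset, hZ.measure_void hlam.le (measurableSet_Ioo.union measurableSet_Ioo)
    (ne_top_of_le_ne_top (by simp) (measure_union_le _ _)),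
    measureReal_union _ measurableSet_Ioo (by simp) (by simp),
    Real.volume_real_Ioo_of_le (by linarith), Real.volume_real_Ioo_of_le hv]
  · congr 4; ring
  · rw [Set.disjoint_left]
    rintro x ⟨h3, h4⟩ ⟨h5, h6⟩
    linarith

/-- Almost surely a Poisson process is unbounded in both directions. -/
lemma ae_exists_lt_gt (hlam : 0 < lam) :
    ∀ᵐ ω ∂P, ∀ z : ℝ, (∃ i, Z i ω < z) ∧ ∃ i, z < Z i ω := by
  have hvoid (B : ℕ → Set ℝ) (hB : ∀ n, MeasurableSet (B n))
      (hvol : ∀ n : ℕ, volume (B n) = n) : P {ω | ∀ n i, Z i ω ∉ B n} = 0 := by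
    have hlim : Tendsto (fun n : ℕ => ENNReal.ofReal (Real.exp (-(lam * n)))) atTop (𝓝 0) := by
      rw [← ENNReal.ofReal_zero]
      refine ENNReal.tendsto_ofReal (Real.tendsto_exp_neg_atTop_nhds_zero.comp ?_)
      exact Tendsto.const_mul_atTop hlam tendsto_natCast_atTop_atTop
    refine le_antisymm (ge_of_tendsto' hlim fun n => ?_) zero_le
    have := hZ.measure_void hlam.le (hB n) (by simp [hvol])
    rw [measureReal_def, hvol, ENNReal.toReal_natCast] at this
    rw [← this]
    exact measure_mono fun ω hω => hω n
  have hr (q : ℕ) := hvoid (fun n => Ioo (q : ℝ) (q + n)) (fun n => measurableSet_Ioo) (by simp)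
  have hl (q : ℕ) := hvoid (fun n => Ioo (-(q : ℝ) - n) (-q)) (fun n => measurableSet_Ioo)
    (by simp)
  have hr' : ∀ᵐ ω ∂P, ∀ q : ℕ, ¬ ∀ n i : ℕ, Z i ω ∉ Ioo (q : ℝ) (q + n) :=
    ae_all_iff.2 fun q => by rw [ae_iff]; simpa using hr q
  have hl' : ∀ᵐ ω ∂P, ∀ q : ℕ, ¬ ∀ n i : ℕ, Z i ω ∉ Ioo (-(q : ℝ) - n) (-q) :=
    ae_all_iff.2 fun q => by rw [ae_iff]; simpa using hl q
  filter_upwards [hr', hl'] with ω h1 h2 z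
  obtain ⟨q, hq⟩ := exists_nat_ge |z|
  obtain ⟨hq1, hq2⟩ := abs_le.1 hq
  have h1 := h1 q
  have h2 := h2 q
  push Not at h1 h2
  obtain ⟨n, i, hi⟩ := h1
  obtain ⟨n', i', hi'⟩ := h2
  exact ⟨⟨i', by linarith [hi'.2]⟩, ⟨i, by linarith [hi.1]⟩⟩

end IsPoissonProcess

/-- The lengths of the two gaps adjacent to `z`. -/
noncomputable def gaps (ζ : ℕ → ℝ) (z : ℝ) : ℝ × ℝ :=
  ((leftGap ζ z).toReal, (rightGap ζ z).toReal)

lemma measurable_gaps : Measurable (fun p : (ℕ → ℝ) × ℝ => gaps p.1 p.2) :=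
  measurable_leftGap.ennreal_toReal.prodMk measurable_rightGap.ennreal_toReal

/-- `toReal` is nonnegative, so a negative threshold acts as zero; this is the source of `max u 0`
in the tails below. -/
lemma gaps_mem_Ici {ζ : ℕ → ℝ} {z : ℝ} (hl : leftGap ζ z ≠ ∞)
    (hr : rightGap ζ z ≠ ∞) (u v : ℝ) :
    gaps ζ z ∈ Ici u ×ˢ Ici v ↔
      ENNReal.ofReal (max u 0) ≤ leftGap ζ z ∧ ENNReal.ofReal (max v 0) ≤ rightGap ζ z := by
  simp [gaps, ENNReal.ofReal_le_iff_le_toReal hl, ENNReal.ofReal_le_iff_le_toReal hr]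

/-! ### Exponential tails and the sum of two exponential variables. -/

section ExponentialGaps

lemma expMeasure_Ici {lam : ℝ} (hlam : 0 < lam) (u : ℝ) :
    expMeasure lam (Ici u) = ENNReal.ofReal (Real.exp (-(lam * max u 0))) := by
  have := isProbabilityMeasure_expMeasure hlam
  have hat : NullSingletonClass (expMeasure lam) := by
    refine ⟨fun x => ?_⟩
    unfold expMeasure gammaMeasure
    exact withDensity_absolutelyContinuous _ _ (measure_singleton x)
  have hIic : expMeasure lam (Iic u)
      = ENNReal.ofReal (if 0 ≤ u then 1 - Real.exp (-(lam * u)) else 0) := by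
    rw [← lintegral_exponentialPDF_eq_antiDeriv hlam]
    unfold expMeasure gammaMeasure
    rw [withDensity_apply _ measurableSet_Iic]
    rfl
  rw [← measure_congr Ioi_ae_eq_Ici, ← compl_Iic, prob_compl_eq_one_sub measurableSet_Iic, hIic]
  split_ifs with h
  · rw [max_eq_left h, ← ENNReal.ofReal_one, ← ENNReal.ofReal_sub _ (by
      rw [sub_nonneg, Real.exp_le_one_iff]; nlinarith)]
    congr 1; ring
  · rw [max_eq_right (by linarith)]
    simp

/-- A finite measure on the plane with exponential joint tails is a multiple of a product of
exponential measures. -/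
lemma eq_smul_expMeasure_prod {lam : ℝ} (hlam : 0 < lam) {μ : Measure (ℝ × ℝ)} [IsFiniteMeasure μ]
    {c : ℝ≥0∞}
    (h : ∀ u v : ℝ, μ (Ici u ×ˢ Ici v)
      = c * ENNReal.ofReal (Real.exp (-(lam * (max u 0 + max v 0))))) :
    μ = c • (expMeasure lam).prod (expMeasure lam) := by
  have := isProbabilityMeasure_expMeasure hlam
  -- Half-lines determine a finite measure on `ℝ`. Fixing one half-line and varying the other
  -- upgrades quadrants to Borel rectangles one coordinate at a time.
  have h1 (v : ℝ) : (μ.restrict (univ ×ˢ Ici v)).map Prod.fst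
      = (c * expMeasure lam (Ici v)) • expMeasure lam := by
    refine Measure.ext_of_Ici _ _ fun u => ?_
    rw [Measure.map_apply measurable_fst measurableSet_Ici,
      Measure.restrict_apply (measurable_fst measurableSet_Ici), Measure.smul_apply, smul_eq_mul,
      expMeasure_Ici hlam, expMeasure_Ici hlam]
    have : Prod.fst ⁻¹' Ici u ∩ (univ : Set ℝ) ×ˢ Ici v = Ici u ×ˢ Ici v := by
      ext x; simp [Prod.le_def]
    rw [this, h, mul_assoc, ← ENNReal.ofReal_mul (Real.exp_pos _).le, ← Real.exp_add]
    congr 3; ring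
  refine Measure.ext_prod fun {s t} hs ht => ?_
  have h2 : (μ.restrict (s ×ˢ univ)).map Prod.snd = (c * expMeasure lam s) • expMeasure lam := by
    refine Measure.ext_of_Ici _ _ fun v => ?_
    have := congrArg (fun ν => ν s) (h1 v)
    simp only [Measure.map_apply measurable_fst hs, Measure.smul_apply, smul_eq_mul,
      Measure.restrict_apply (measurable_fst hs)] at this
    rw [Measure.map_apply measurable_snd measurableSet_Ici,
      Measure.restrict_apply (measurable_snd measurableSet_Ici), Measure.smul_apply, smul_eq_mul]
    have e : Prod.snd ⁻¹' Ici v ∩ s ×ˢ (univ : Set ℝ)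
      = Prod.fst ⁻¹' s ∩ (univ : Set ℝ) ×ˢ Ici v := by ext; simp [and_comm]
    rw [e, this]; ring
  have := congrArg (fun ν => ν t) h2
  simp only [Measure.map_apply measurable_snd ht, Measure.smul_apply, smul_eq_mul,
      Measure.restrict_apply (measurable_snd ht)] at this
  rw [Measure.smul_apply, Measure.prod_prod, smul_eq_mul, ← mul_assoc, ← this]
  congr 1
  ext; simp [and_comm]

/-- The sum of two independent exponential variables has a gamma distribution. -/
lemma lintegral_add_expMeasure_prod {lam : ℝ} (hlam : 0 < lam) {G : ℝ → ℝ≥0∞} (hG : Measurable G) :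
    ∫⁻ p, G (p.1 + p.2) ∂((expMeasure lam).prod (expMeasure lam))
      = ∫⁻ s, G s * ENNReal.ofReal (lam ^ 2 * s * Real.exp (-(lam * s))) := by
  have := isProbabilityMeasure_expMeasure hlam
  have hmeas : Measurable (exponentialPDF lam) :=
    ENNReal.measurable_ofReal.comp (measurable_exponentialPDFReal lam)
  have hexp : expMeasure lam = volume.withDensity (exponentialPDF lam) := rfl
  have hinner : Measurable fun x => ∫⁻ y, G (x + y) ∂(volume.withDensity (exponentialPDF lam)) := by
    rw [← hexp]
    exact Measurable.lintegral_prod_right' (f := fun p : ℝ × ℝ => G (p.1 + p.2)) (by fun_prop)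
  rw [lintegral_prod _ (by fun_prop)]
  calc ∫⁻ x, ∫⁻ y, G (x + y) ∂(expMeasure lam) ∂(expMeasure lam)
      = ∫⁻ x, exponentialPDF lam x * ∫⁻ s, exponentialPDF lam (s - x) * G s := by
        rw [hexp, lintegral_withDensity_eq_lintegral_mul _ hmeas
          hinner]
        refine lintegral_congr fun x => ?_
        simp only [Pi.mul_apply]
        rw [lintegral_withDensity_eq_lintegral_mul _ hmeas (by fun_prop)]
        congr 1
        rw [← lintegral_add_left_eq_self (fun s => exponentialPDF lam (s - x) * G s) x]
        simp
    _ = ∫⁻ x, ∫⁻ s, exponentialPDF lam x * (exponentialPDF lam (s - x) * G s) := by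
        refine lintegral_congr fun x => ?_
        rw [lintegral_const_mul _ (by fun_prop)]
    _ = ∫⁻ s, ∫⁻ x, exponentialPDF lam x * (exponentialPDF lam (s - x) * G s) := by
        rw [lintegral_lintegral_swap]
        exact Measurable.aemeasurable (by fun_prop)
    _ = _ := by
        refine lintegral_congr fun s => ?_
        -- For fixed `s` the product of the two densities does not depend on `x` in `[0, s]` and
        -- vanishes elsewhere; the length `s` of this interval gives the linear factor.
        have e (x : ℝ) : exponentialPDF lam x * (exponentialPDF lam (s - x) * G s)
            = (Icc 0 s).indicator
              (fun _ => G s * ENNReal.ofReal (lam ^ 2 * Real.exp (-(lam * s)))) x := by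
          by_cases h : x ∈ Icc 0 s
          · rw [indicator_of_mem h, exponentialPDF_of_nonneg h.1,
              exponentialPDF_of_nonneg (sub_nonneg.2 h.2), ← mul_assoc, mul_comm _ (G s),
              ← ENNReal.ofReal_mul (by positivity)]
            congr 2
            rw [show -(lam * s) = -(lam * x) + -(lam * (s - x)) by ring, Real.exp_add]
            ring
          · rw [indicator_of_notMem h]
            rcases not_and_or.1 h with h | h
            · rw [exponentialPDF_of_neg (not_le.1 h), zero_mul]
            · rw [exponentialPDF_of_neg (x := s - x) (by linarith), zero_mul, mul_zero]
        simp_rw [e]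
        rw [lintegral_indicator_const measurableSet_Icc, Real.volume_Icc, sub_zero, mul_assoc,
          ← ENNReal.ofReal_mul (by positivity)]
        congr 2
        ring

end ExponentialGaps

/-! ### Law of the gap pair at the origin and at the points. -/

namespace IsPoissonProcess

variable {Ω : Type*} [MeasurableSpace Ω] {P : Measure Ω} {Z : ℕ → Ω → ℝ} {lam : ℝ}

variable (hZ : IsPoissonProcess P Z lam)
include hZ

lemma measurable_gaps_comp {f : Ω → ℝ} (hf : Measurable f) :
    Measurable (fun ω => gaps (fun j => Z j ω) (f ω)) :=
  measurable_gaps.comp ((measurable_pi_lambda _ hZ.measurable).prodMk hf)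

lemma ae_gaps_ne_top (hlam : 0 < lam) :
    ∀ᵐ ω ∂P, ∀ z, leftGap (fun j => Z j ω) z ≠ ∞ ∧ rightGap (fun j => Z j ω) z ≠ ∞ := by
  filter_upwards [hZ.ae_exists_lt_gt hlam] with ω hω z
  obtain ⟨⟨i, hi⟩, j, hj⟩ := hω z
  exact ⟨leftGap_ne_top (j := i) hi, rightGap_ne_top (j := j) hj⟩

/-- The gaps around the origin are independent and exponential. -/
lemma map_gaps_zero [IsProbabilityMeasure P] (hlam : 0 < lam) :
    P.map (fun ω => gaps (fun j => Z j ω) 0) = (expMeasure lam).prod (expMeasure lam) := by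
  rw [← one_smul ℝ≥0∞ ((expMeasure lam).prod (expMeasure lam))]
  refine eq_smul_expMeasure_prod hlam fun u v => ?_
  rw [Measure.map_apply (hZ.measurable_gaps_comp measurable_const)
    (measurableSet_Ici.prod measurableSet_Ici), one_mul,
    ← hZ.measure_gaps_zero hlam (le_max_right u 0) (le_max_right v 0)]
  refine measure_congr ?_
  filter_upwards [hZ.ae_gaps_ne_top hlam] with ω hω
  exact propext (gaps_mem_Ici (hω 0).1 (hω 0).2 u v)

/-- The gaps around the points of a Poisson process in a set `B` have the same law as those around
the origin, up to a factor. -/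
lemma sum_map_gaps [IsProbabilityMeasure P] (hlam : 0 < lam) {B : Set ℝ} (hB : MeasurableSet B)
    (hfin : volume B ≠ ∞) :
    Measure.sum (fun i =>
        (P.restrict (Z i ⁻¹' B)).map (fun ω => gaps (fun j => Z j ω) (Z i ω)))
      = (ENNReal.ofReal lam * volume B) • (expMeasure lam).prod (expMeasure lam) := by
  set μ := Measure.sum (fun i =>
        (P.restrict (Z i ⁻¹' B)).map (fun ω => gaps (fun j => Z j ω) (Z i ω))) with hμ
  have key (u v : ℝ) : μ (Ici u ×ˢ Ici v) = ENNReal.ofReal lam * volume B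
      * ENNReal.ofReal (Real.exp (-(lam * (max u 0 + max v 0)))) := by
    rw [← hZ.tsum_measure_gaps hlam hB hfin (le_max_right u 0) (le_max_right v 0), hμ,
      Measure.sum_apply _ (measurableSet_Ici.prod measurableSet_Ici)]
    refine tsum_congr fun i => ?_
    rw [Measure.map_apply (hZ.measurable_gaps_comp (hZ.measurable i))
      (measurableSet_Ici.prod measurableSet_Ici),
      Measure.restrict_apply (hZ.measurable_gaps_comp (hZ.measurable i)
      (measurableSet_Ici.prod measurableSet_Ici))]
    refine measure_congr ?_
    filter_upwards [hZ.ae_gaps_ne_top hlam] with ω hω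
    refine propext ?_
    have := gaps_mem_Ici (hω (Z i ω)).1 (hω (Z i ω)).2 u v
    exact (and_congr_left' this).trans and_comm
  -- The gaps are nonnegative, so the tail formula at `(0, 0)` gives the total mass and hence
  -- finiteness.
  have hsupp : μ (Ici 0 ×ˢ Ici 0) = μ univ := by
    rw [hμ, Measure.sum_apply _ (measurableSet_Ici.prod measurableSet_Ici),
      Measure.sum_apply _ MeasurableSet.univ]
    refine tsum_congr fun i => ?_
    rw [Measure.map_apply (hZ.measurable_gaps_comp (hZ.measurable i))
      (measurableSet_Ici.prod measurableSet_Ici),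
      Measure.map_apply (hZ.measurable_gaps_comp (hZ.measurable i)) MeasurableSet.univ]
    congr 1
    ext ω
    simp [gaps]
  have : IsFiniteMeasure μ := by
    refine ⟨?_⟩
    rw [← hsupp, key]
    exact ENNReal.mul_lt_top (ENNReal.mul_lt_top ENNReal.ofReal_lt_top hfin.lt_top)
      ENNReal.ofReal_lt_top
  exact eq_smul_expMeasure_prod hlam key

end IsPoissonProcess

/-! ### Voronoi cells on the line. -/

section VoronoiCell

lemma mem_voronoiCell_range {ζ : ℕ → ℝ} {z x : ℝ} :
    x ∈ voronoiCell (range ζ) z ↔ ∀ j, ζ j ≠ z → |x - z| ≤ |x - ζ j| := by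
  simp [voronoiCell]

lemma voronoiCell_insert_self (Z : Set ℝ) (z : ℝ) :
    voronoiCell (insert z Z) z = voronoiCell Z z := by
  simp [voronoiCell]

lemma abs_sub_le_abs_sub_iff_of_lt {x z w : ℝ} (h : z < w) :
    |x - z| ≤ |x - w| ↔ 2 * (x - z) ≤ w - z := by
  rw [← sq_le_sq]
  constructor <;> intro h' <;> nlinarith

lemma abs_sub_le_abs_sub_iff_of_gt {x z w : ℝ} (h : w < z) :
    |x - z| ≤ |x - w| ↔ 2 * (z - x) ≤ z - w := by
  rw [← sq_le_sq]
  constructor <;> intro h' <;> nlinarith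

/-- The Voronoi cell of a point extends half-way to its neighbours. -/
lemma voronoiCell_range_eq_Icc {ζ : ℕ → ℝ} {z : ℝ} (hl : leftGap ζ z ≠ ∞)
    (hr : rightGap ζ z ≠ ∞) :
    voronoiCell (range ζ) z = Icc (z - (gaps ζ z).1 / 2) (z + (gaps ζ z).2 / 2) := by
  ext x
  have h1 : z - (gaps ζ z).1 / 2 ≤ x ↔ ENNReal.ofReal (2 * (z - x)) ≤ leftGap ζ z := by
    rw [ENNReal.ofReal_le_iff_le_toReal hl, gaps]
    constructor <;> intro h <;> linarith
  have h2 : x ≤ z + (gaps ζ z).2 / 2 ↔ ENNReal.ofReal (2 * (x - z)) ≤ rightGap ζ z := by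
    rw [ENNReal.ofReal_le_iff_le_toReal hr, gaps]
    constructor <;> intro h <;> linarith
  rw [mem_Icc, h1, h2, ofReal_le_leftGap, ofReal_le_rightGap, mem_voronoiCell_range]
  constructor
  · intro h
    exact ⟨fun j hj => (abs_sub_le_abs_sub_iff_of_gt hj).1 (h j hj.ne),
      fun j hj => (abs_sub_le_abs_sub_iff_of_lt hj).1 (h j hj.ne')⟩
  · rintro ⟨h1, h2⟩ j hj
    rcases lt_or_gt_of_ne hj with h | h
    · exact (abs_sub_le_abs_sub_iff_of_gt h).2 (h1 j h)
    · exact (abs_sub_le_abs_sub_iff_of_lt h).2 (h2 j h)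

lemma one_le_load_iff {Z Y : Set ℝ} {z : ℝ} :
    1 ≤ load Z Y z ↔ (Y ∩ voronoiCell Z z).Nonempty := one_le_encard_iff_nonempty

lemma one_le_typicalLoad_iff {Z Y : Set ℝ} :
    1 ≤ typicalLoad Z Y ↔ (Y ∩ voronoiCell Z 0).Nonempty := by
  rw [typicalLoad, one_le_load_iff, voronoiCell_insert_self]

end VoronoiCell

/-- Conditioning on `ζ`: independence makes the joint law a product, and Fubini freezes the first
component. -/
lemma measure_prodMk_of_indepFun {Ω α β : Type*} [MeasurableSpace Ω] [MeasurableSpace α]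
    [MeasurableSpace β] {P : Measure Ω} [IsProbabilityMeasure P] {ζ : Ω → α} {ξ : Ω → β}
    (hζ : Measurable ζ) (hξ : Measurable ξ) (hind : IndepFun ζ ξ P) {S : Set (α × β)}
    (hS : MeasurableSet S) :
    P {ω | (ζ ω, ξ ω) ∈ S} = ∫⁻ ω, P {ω' | (ζ ω, ξ ω') ∈ S} ∂P := by
  have h := hind.map_prod_eq_prod_map_map hζ.aemeasurable hξ.aemeasurable
  have := Measure.isProbabilityMeasure_map (μ := P) hξ.aemeasurable
  calc P {ω | (ζ ω, ξ ω) ∈ S} = P.map (fun ω => (ζ ω, ξ ω)) S :=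
        (Measure.map_apply (hζ.prodMk hξ) hS).symm
    _ = ∫⁻ x, P.map ξ (Prod.mk x ⁻¹' S) ∂(P.map ζ) := by rw [h, Measure.prod_apply hS]
    _ = ∫⁻ ω, P.map ξ (Prod.mk (ζ ω) ⁻¹' S) ∂P :=
        lintegral_map (measurable_measure_prodMk_left hS) hζ
    _ = _ := lintegral_congr fun ω => Measure.map_apply hξ (measurable_prodMk_left hS)

/-! ### Traffic with a void function of the length, independent of the RSUs. -/

/-- A random set of vehicles `Y (ξ ω)`, enumerated measurably by partially defined points, such that
the probability that a closed interval contains no vehicle is a function `φ` of its length. -/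
structure IsStationaryTraffic {Ω E ι : Type*} [MeasurableSpace Ω] [MeasurableSpace E]
    (P : Measure Ω) (ξ : Ω → E) (D : ι → Set E) (W : ι → E → ℝ) (Y : E → Set ℝ)
    (φ : ℝ → ℝ) : Prop where
  measurable : Measurable ξ
  measurableSet_domain : ∀ i, MeasurableSet (D i)
  measurable_point : ∀ i, Measurable (W i)
  eq_points : ∀ e, Y e = {y | ∃ i, e ∈ D i ∧ y = W i e}
  measurable_void : Measurable φ
  void_nonneg : ∀ t, 0 ≤ φ t
  measure_void : ∀ p q, p ≤ q → P {ω | Y (ξ ω) ∩ Icc p q = ∅} = ENNReal.ofReal (φ (q - p))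

namespace IsStationaryTraffic

variable {Ω E ι : Type*} [MeasurableSpace Ω] [MeasurableSpace E] [Countable ι]
  {P : Measure Ω} [IsProbabilityMeasure P] {ξ : Ω → E} {D : ι → Set E} {W : ι → E → ℝ}
  {Y : E → Set ℝ} {φ : ℝ → ℝ} {Z : ℕ → Ω → ℝ} {lam : ℝ}

omit [Countable ι] [IsProbabilityMeasure P] in
lemma inter_eq_empty_iff (hY : IsStationaryTraffic P ξ D W Y φ) {e : E} {A : Set ℝ} :
    Y e ∩ A = ∅ ↔ ∀ i, e ∈ D i → W i e ∉ A := by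
  rw [hY.eq_points, Set.eq_empty_iff_forall_notMem]
  constructor
  · intro h i hi hA
    exact h _ ⟨⟨i, hi, rfl⟩, hA⟩
  · rintro h x ⟨⟨i, hi, rfl⟩, hA⟩
    exact h i hi hA

omit [IsProbabilityMeasure P] in
lemma measurableSet_missed (hY : IsStationaryTraffic P ξ D W Y φ) {F : (ℕ → ℝ) → ℝ}
    (hF : Measurable F) :
    MeasurableSet {p : (ℕ → ℝ) × E | Y p.2 ∩ voronoiCell (range p.1) (F p.1) = ∅} := by
  simp only [hY.inter_eq_empty_iff, mem_voronoiCell_range]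
  have hFm : Measurable fun p : (ℕ → ℝ) × E => F p.1 := hF.comp measurable_fst
  have hW (i : ι) : Measurable fun p : (ℕ → ℝ) × E => W i p.2 :=
    (hY.measurable_point i).comp measurable_snd
  have hj (j : ℕ) : Measurable fun p : (ℕ → ℝ) × E => p.1 j := by fun_prop
  have hcell (i : ι) : MeasurableSet
      {p : (ℕ → ℝ) × E | ∀ j, p.1 j ≠ F p.1 → |W i p.2 - F p.1| ≤ |W i p.2 - p.1 j|} := by
    rw [ofPred_forall]
    refine MeasurableSet.iInter fun j => ?_
    have h1 : MeasurableSet {p : (ℕ → ℝ) × E | p.1 j = F p.1} := measurableSet_eq_fun (hj j) hFm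
    have h2 : MeasurableSet {p : (ℕ → ℝ) × E | |W i p.2 - F p.1| ≤ |W i p.2 - p.1 j|} :=
      measurableSet_le ((hW i).sub hFm).abs ((hW i).sub (hj j)).abs
    convert h1.union h2 using 1
    ext p
    simp only [mem_ofPred_eq, mem_union]
    tauto
  rw [ofPred_forall]
  refine MeasurableSet.iInter fun i => ?_
  convert (measurable_snd (hY.measurableSet_domain i)).compl.union (hcell i).compl using 1
  ext p
  simp only [mem_ofPred_eq, mem_union, mem_compl_iff, mem_preimage]
  tauto

/-- With the RSUs frozen, the cell is a fixed interval of length half the sum of the gaps, so `φ`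
applies. The selector `F` covers both uses: the constant `0` for the typical RSU and the `i`-th
coordinate for an actual one. The event `A` restricts the latter to `B`. -/
lemma measure_missed (hY : IsStationaryTraffic P ξ D W Y φ) (hZ : IsPoissonProcess P Z lam)
    (hlam : 0 < lam) (hind : IndepFun (fun ω i => Z i ω) ξ P) {F : (ℕ → ℝ) → ℝ}
    (hF : Measurable F) {A : Set (ℕ → ℝ)} (hA : MeasurableSet A) :
    P {ω | (fun j => Z j ω) ∈ A ∧
        Y (ξ ω) ∩ voronoiCell (points Z ω) (F (fun j => Z j ω)) = ∅}
      = ∫⁻ ω in (fun ω j => Z j ω) ⁻¹' A, ENNReal.ofReal (φ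
          (((gaps (fun j => Z j ω) (F (fun j => Z j ω))).1
            + (gaps (fun j => Z j ω) (F (fun j => Z j ω))).2) / 2)) ∂P := by
  have hZm : Measurable fun ω j => Z j ω := measurable_pi_lambda _ hZ.measurable
  have h := measure_prodMk_of_indepFun hZm hY.measurable hind
    ((measurable_fst hA).inter (hY.measurableSet_missed hF))
  refine h.trans ?_
  rw [← lintegral_indicator (hZm hA)]
  refine lintegral_congr_ae ?_
  filter_upwards [hZ.ae_gaps_ne_top hlam] with ω hω
  by_cases hωA : (fun j => Z j ω) ∈ A
  · rw [indicator_of_mem (show ω ∈ (fun ω j => Z j ω) ⁻¹' A from hωA)]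
    set z := F (fun j => Z j ω) with hz
    have hcell := voronoiCell_range_eq_Icc (hω z).1 (hω z).2
    set l := (gaps (fun j => Z j ω) z).1 with hl
    set r := (gaps (fun j => Z j ω) z).2 with hr
    have hl0 : 0 ≤ l := ENNReal.toReal_nonneg
    have hr0 : 0 ≤ r := ENNReal.toReal_nonneg
    have := hY.measure_void (z - l / 2) (z + r / 2) (by linarith)
    rw [show z + r / 2 - (z - l / 2) = (l + r) / 2 by ring, ← hcell] at this
    rw [← this]
    congr 1
    ext ω'
    simp only [mem_inter_iff, mem_preimage, mem_ofPred_eq, hωA, true_and]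
    rfl
  · rw [indicator_of_notMem (show ω ∉ (fun ω j => Z j ω) ⁻¹' A from hωA)]
    refine measure_mono_null (fun ω' hω' => ?_) measure_empty
    exact absurd hω'.1 hωA

end IsStationaryTraffic

namespace IsStationaryTraffic

variable {Ω E ι : Type*} [MeasurableSpace Ω] [MeasurableSpace E] [Countable ι]
  {P : Measure Ω} [IsProbabilityMeasure P] {ξ : Ω → E} {D : ι → Set E} {W : ι → E → ℝ}
  {Y : E → Set ℝ} {φ : ℝ → ℝ} {Z : ℕ → Ω → ℝ} {lam : ℝ}

lemma measure_missed_zero (hY : IsStationaryTraffic P ξ D W Y φ) (hZ : IsPoissonProcess P Z lam)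
    (hlam : 0 < lam) (hind : IndepFun (fun ω i => Z i ω) ξ P) :
    P {ω | Y (ξ ω) ∩ voronoiCell (points Z ω) 0 = ∅}
      = ∫⁻ s, ENNReal.ofReal (φ (s / 2))
          * ENNReal.ofReal (lam ^ 2 * s * Real.exp (-(lam * s))) := by
  have hφ := hY.measurable_void
  have h := hY.measure_missed hZ hlam hind (F := fun _ => 0) measurable_const MeasurableSet.univ
  simp only [mem_univ, true_and, preimage_univ, Measure.restrict_univ] at h
  rw [h, ← lintegral_add_expMeasure_prod hlam (G := fun s => ENNReal.ofReal (φ (s / 2)))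
    (by fun_prop), ← hZ.map_gaps_zero hlam, lintegral_map (by fun_prop)
    (hZ.measurable_gaps_comp measurable_const)]

omit [IsProbabilityMeasure P] in
lemma measurableSet_missed_comp (hY : IsStationaryTraffic P ξ D W Y φ)
    (hZ : IsPoissonProcess P Z lam) {F : (ℕ → ℝ) → ℝ} (hF : Measurable F) :
    MeasurableSet {ω | Y (ξ ω) ∩ voronoiCell (points Z ω) (F (fun j => Z j ω)) = ∅} :=
  ((measurable_pi_lambda _ hZ.measurable).prodMk hY.measurable) (hY.measurableSet_missed hF)

/-- Both sides integrate the same function of the gap pair; `sum_map_gaps` identifies the summed law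
at the points with a multiple of the law at the origin. -/
lemma tsum_measure_missed (hY : IsStationaryTraffic P ξ D W Y φ) (hZ : IsPoissonProcess P Z lam)
    (hlam : 0 < lam) (hind : IndepFun (fun ω i => Z i ω) ξ P) {B : Set ℝ} (hB : MeasurableSet B)
    (hfin : volume B ≠ ∞) :
    ∑' i, P (Z i ⁻¹' B ∩ {ω | Y (ξ ω) ∩ voronoiCell (points Z ω) (Z i ω) = ∅})
      = ENNReal.ofReal lam * volume B * P {ω | Y (ξ ω) ∩ voronoiCell (points Z ω) 0 = ∅} := by
  have hφ := hY.measurable_void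
  rw [hY.measure_missed_zero hZ hlam hind,
    ← lintegral_add_expMeasure_prod hlam (G := fun s => ENNReal.ofReal (φ (s / 2))) (by fun_prop),
    ← smul_eq_mul (a := ENNReal.ofReal lam * volume B), ← lintegral_smul_measure,
    ← hZ.sum_map_gaps hlam hB hfin, lintegral_sum_measure]
  refine tsum_congr fun i => ?_
  rw [lintegral_map (by fun_prop) (hZ.measurable_gaps_comp (hZ.measurable i))]
  exact hY.measure_missed hZ hlam hind (F := fun ζ => ζ i) (by fun_prop)
    (A := (fun ζ => ζ i) ⁻¹' B) (measurable_pi_apply i hB)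

/-- Active and inactive points together have intensity `lam`, so the inactive share can be
subtracted when `B` has finite length. A general `B` is cut into unit cells. -/
lemma tsum_measure_active (hY : IsStationaryTraffic P ξ D W Y φ) (hZ : IsPoissonProcess P Z lam)
    (hlam : 0 < lam) (hind : IndepFun (fun ω i => Z i ω) ξ P) {B : Set ℝ} (hB : MeasurableSet B) :
    ∑' i, P (Z i ⁻¹' B ∩ {ω | 1 ≤ load (points Z ω) (Y (ξ ω)) (Z i ω)})
      = ENNReal.ofReal lam * volume B * P {ω | 1 ≤ typicalLoad (points Z ω) (Y (ξ ω))} := by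
  have hM (i : ℕ) : MeasurableSet {ω | Y (ξ ω) ∩ voronoiCell (points Z ω) (Z i ω) = ∅} :=
    hY.measurableSet_missed_comp hZ (F := fun ζ => ζ i) (by fun_prop)
  have hM0 : MeasurableSet {ω | Y (ξ ω) ∩ voronoiCell (points Z ω) 0 = ∅} :=
    hY.measurableSet_missed_comp hZ (F := fun _ => 0) (by fun_prop)
  have hact (i : ℕ) : {ω | 1 ≤ load (points Z ω) (Y (ξ ω)) (Z i ω)}
      = {ω | Y (ξ ω) ∩ voronoiCell (points Z ω) (Z i ω) = ∅}ᶜ := by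
    ext ω
    simp [one_le_load_iff, nonempty_iff_ne_empty]
  have hact0 : {ω | 1 ≤ typicalLoad (points Z ω) (Y (ξ ω))}
      = {ω | Y (ξ ω) ∩ voronoiCell (points Z ω) 0 = ∅}ᶜ := by
    ext ω
    simp [one_le_typicalLoad_iff, nonempty_iff_ne_empty]
  have main {B : Set ℝ} (hB : MeasurableSet B) (hfin : volume B ≠ ∞) :
      ∑' i, P (Z i ⁻¹' B ∩ {ω | 1 ≤ load (points Z ω) (Y (ξ ω)) (Z i ω)})
      = ENNReal.ofReal lam * volume B * P {ω | 1 ≤ typicalLoad (points Z ω) (Y (ξ ω))} := by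
    have htot := hZ.tsum_measure_preimage hB hfin
    have hsum : ∑' i, P (Z i ⁻¹' B ∩ {ω | Y (ξ ω) ∩ voronoiCell (points Z ω) (Z i ω) = ∅})
        + ∑' i, P (Z i ⁻¹' B ∩ {ω | 1 ≤ load (points Z ω) (Y (ξ ω)) (Z i ω)})
        = ENNReal.ofReal lam * volume B := by
      rw [← htot, ← ENNReal.tsum_add]
      refine tsum_congr fun i => ?_
      rw [hact, ← sdiff_eq]
      exact measure_inter_add_sdiff _ (hM i)
    have hsplit : P {ω | Y (ξ ω) ∩ voronoiCell (points Z ω) 0 = ∅}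
        + P {ω | 1 ≤ typicalLoad (points Z ω) (Y (ξ ω))} = 1 := by
      rw [hact0]
      exact prob_add_prob_compl hM0
    rw [hY.tsum_measure_missed hZ hlam hind hB hfin] at hsum
    have hne : ENNReal.ofReal lam * volume B
        * P {ω | Y (ξ ω) ∩ voronoiCell (points Z ω) 0 = ∅} ≠ ∞ :=
      ENNReal.mul_ne_top (ENNReal.mul_ne_top ENNReal.ofReal_ne_top hfin) (measure_ne_top _ _)
    refine (ENNReal.add_right_inj hne).1 ?_
    rw [hsum, ← mul_add, hsplit, mul_one]
  have hAm (i : ℕ) : MeasurableSet {ω | 1 ≤ load (points Z ω) (Y (ξ ω)) (Z i ω)} := by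
    rw [hact]; exact (hM i).compl
  calc _ = ∑' i, ∑' k : ℤ, P (Z i ⁻¹' (B ∩ gridCell 1 k)
          ∩ {ω | 1 ≤ load (points Z ω) (Y (ξ ω)) (Z i ω)}) := by
        refine tsum_congr fun i => ?_
        rw [measure_eq_tsum_gridCell P (hZ.measurable i) ((hZ.measurable i hB).inter (hAm i))
          one_pos]
        simp_rw [preimage_inter, inter_right_comm]
    _ = ∑' k : ℤ, ENNReal.ofReal lam * volume (B ∩ gridCell 1 k)
          * P {ω | 1 ≤ typicalLoad (points Z ω) (Y (ξ ω))} := by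
        rw [ENNReal.tsum_comm]
        refine tsum_congr fun k => main (hB.inter (measurableSet_gridCell 1 k)) ?_
        exact measure_ne_top_of_subset inter_subset_right (by simp [gridCell])
    _ = _ := by
        rw [ENNReal.tsum_mul_right, ENNReal.tsum_mul_left, ← volume_eq_tsum_gridCell hB one_pos]

/-- The density of the active RSUs is the active probability times the density of the RSUs. -/
theorem hasDensity_activeRSUs (hY : IsStationaryTraffic P ξ D W Y φ)
    (hZ : IsPoissonProcess P Z lam) (hlam : 0 < lam) (hind : IndepFun (fun ω i => Z i ω) ξ P) :
    HasDensity P (fun ω => activeRSUs (points Z ω) (Y (ξ ω)))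
      (activeProb P (points Z) (fun ω => Y (ξ ω)) * lam) := by
  intro B hB
  have hAm (i : ℕ) : MeasurableSet {ω | 1 ≤ load (points Z ω) (Y (ξ ω)) (Z i ω)} := by
    convert (hY.measurableSet_missed_comp hZ (F := fun ζ => ζ i) (by fun_prop)).compl using 1
    ext ω
    simp [one_le_load_iff, nonempty_iff_ne_empty]
  have hcount : ∀ᵐ ω ∂P,
      (((activeRSUs (points Z ω) (Y (ξ ω)) ∩ B).encard : ℕ∞) : ℝ≥0∞)
        = ∑' i, (Z i ⁻¹' B ∩ {ω | 1 ≤ load (points Z ω) (Y (ξ ω)) (Z i ω)}).indicator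
            (fun _ => 1) ω := by
    -- `HasDensity` counts positions while the sums run over indices; almost sure injectivity makes
    -- the two agree.
    filter_upwards [hZ.ae_injective hlam] with ω hω
    have : activeRSUs (points Z ω) (Y (ξ ω)) ∩ B = (fun i => Z i ω) ''
        {i | ω ∈ Z i ⁻¹' B ∩ {ω | 1 ≤ load (points Z ω) (Y (ξ ω)) (Z i ω)}} := by
      ext z
      constructor
      · rintro ⟨⟨⟨i, rfl⟩, h⟩, hzB⟩
        exact ⟨i, ⟨hzB, h⟩, rfl⟩
      · rintro ⟨i, ⟨hzB, h⟩, rfl⟩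
        exact ⟨⟨⟨i, rfl⟩, h⟩, hzB⟩
    rw [this, hω.encard_image, toENNReal_encard_eq_tsum]
    rfl
  rw [lintegral_congr_ae hcount, lintegral_tsum fun i =>
    (measurable_const.indicator ((hZ.measurable i hB).inter (hAm i))).aemeasurable]
  have hone (i : ℕ) := lintegral_indicator_one (μ := P) ((hZ.measurable i hB).inter (hAm i))
  refine (tsum_congr hone).trans ?_
  rw [hY.tsum_measure_active hZ hlam hind hB, activeProb, mul_comm (P.real _),
    ENNReal.ofReal_mul hlam.le, ofReal_measureReal, mul_right_comm]

theorem activeProb_eq_one_sub_loadPMF (hY : IsStationaryTraffic P ξ D W Y φ)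
    (hZ : IsPoissonProcess P Z lam) :
    activeProb P (points Z) (fun ω => Y (ξ ω)) = 1 - loadPMF P (points Z) (fun ω => Y (ξ ω)) 0 := by
  have hM0 := hY.measurableSet_missed_comp hZ (F := fun _ => 0) (by fun_prop)
  have h0 : {ω | typicalLoad (points Z ω) (Y (ξ ω)) = ((0 : ℕ) : ℕ∞)}
      = {ω | Y (ξ ω) ∩ voronoiCell (points Z ω) 0 = ∅} := by
    ext ω
    simp [typicalLoad, load, voronoiCell_insert_self]
  have h1 : {ω | 1 ≤ typicalLoad (points Z ω) (Y (ξ ω))}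
      = {ω | Y (ξ ω) ∩ voronoiCell (points Z ω) 0 = ∅}ᶜ := by
    ext ω
    simp [one_le_typicalLoad_iff, nonempty_iff_ne_empty]
  rw [activeProb, loadPMF, h0, h1, probReal_compl_eq_one_sub hM0]

omit [Countable ι] [IsProbabilityMeasure P] in
-- For `s ≤ 0` the gamma expression is nonpositive and `ENNReal.ofReal` sends it to zero.
lemma lintegral_void_eq (hY : IsStationaryTraffic P ξ D W Y φ) (hlam : 0 < lam) :
    ∫⁻ s, ENNReal.ofReal (φ (s / 2)) * ENNReal.ofReal (lam ^ 2 * s * Real.exp (-(lam * s)))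
      = ∫⁻ s in Ioi 0, ENNReal.ofReal (φ (s / 2) * (lam ^ 2 * s * Real.exp (-(lam * s)))) := by
  rw [← lintegral_indicator measurableSet_Ioi]
  refine lintegral_congr fun s => ?_
  rw [← ENNReal.ofReal_mul (hY.void_nonneg _)]
  by_cases hs : 0 < s
  · rw [indicator_of_mem (mem_Ioi.2 hs)]
  · rw [indicator_of_notMem (by simpa using hs), ENNReal.ofReal_eq_zero]
    refine mul_nonpos_of_nonneg_of_nonpos (hY.void_nonneg _) ?_
    exact mul_nonpos_of_nonpos_of_nonneg
      (mul_nonpos_of_nonneg_of_nonpos (by positivity) (not_lt.1 hs)) (Real.exp_pos _).le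

/-- The integrand is nonnegative and its integral is a probability. -/
theorem integrableOn_void (hY : IsStationaryTraffic P ξ D W Y φ)
    (hZ : IsPoissonProcess P Z lam) (hlam : 0 < lam) (hind : IndepFun (fun ω i => Z i ω) ξ P) :
    IntegrableOn (fun s => φ (s / 2) * (lam ^ 2 * s * Real.exp (-(lam * s)))) (Ioi 0) := by
  have hφ := hY.measurable_void
  refine ⟨Measurable.aestronglyMeasurable (by fun_prop), ?_⟩
  rw [hasFiniteIntegral_iff_ofReal]
  · rw [← hY.lintegral_void_eq hlam, ← hY.measure_missed_zero hZ hlam hind]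
    exact measure_lt_top _ _
  · refine (ae_restrict_iff' measurableSet_Ioi).2 (.of_forall fun s (hs : 0 < s) => ?_)
    exact mul_nonneg (hY.void_nonneg _) (by positivity)

theorem activeProb_eq (hY : IsStationaryTraffic P ξ D W Y φ)
    (hZ : IsPoissonProcess P Z lam) (hlam : 0 < lam) (hind : IndepFun (fun ω i => Z i ω) ξ P) :
    activeProb P (points Z) (fun ω => Y (ξ ω))
      = 1 - ∫ s in Ioi 0, φ (s / 2) * (lam ^ 2 * s * Real.exp (-(lam * s))) := by
  have hφ := hY.measurable_void
  have hM0 := hY.measurableSet_missed_comp hZ (F := fun _ => 0) (by fun_prop)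
  have h1 : {ω | 1 ≤ typicalLoad (points Z ω) (Y (ξ ω))}
      = {ω | Y (ξ ω) ∩ voronoiCell (points Z ω) 0 = ∅}ᶜ := by
    ext ω
    simp [one_le_typicalLoad_iff, nonempty_iff_ne_empty]
  rw [activeProb, h1, probReal_compl_eq_one_sub hM0, measureReal_def,
    hY.measure_missed_zero hZ hlam hind, hY.lintegral_void_eq hlam,
    integral_eq_lintegral_of_nonneg_ae]
  · refine (ae_restrict_iff' measurableSet_Ioi).2 (.of_forall fun s (hs : 0 < s) => ?_)
    exact mul_nonneg (hY.void_nonneg _) (by positivity)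
  · exact Measurable.aestronglyMeasurable (by fun_prop)

end IsStationaryTraffic

/-! ### Laplace functional of a Poisson process. -/

/-- The set where `f`, rounded down to a multiple of `1 / n`, equals `k / n`. -/
def levelSet (f : ℝ → ℝ) (S : Set ℝ) (n k : ℕ) : Set ℝ := S ∩ {x | ⌊f x * n⌋₊ = k}

lemma measurableSet_levelSet {f : ℝ → ℝ} (hf : Measurable f) {S : Set ℝ} (hS : MeasurableSet S)
    (n k : ℕ) : MeasurableSet (levelSet f S n k) :=
  hS.inter ((Nat.measurable_floor.comp (hf.mul_const _)) (measurableSet_singleton k))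

lemma tendsto_floor_mul_div {x : ℝ} (hx : 0 ≤ x) :
    Tendsto (fun n : ℕ => (⌊x * n⌋₊ : ℝ) / n) atTop (𝓝 x) :=
  (tendsto_nat_floor_mul_div_atTop hx).comp tendsto_natCast_atTop_atTop

namespace IsPoissonProcess

variable {Ω : Type*} [MeasurableSpace Ω] {P : Measure Ω} [IsProbabilityMeasure P]
  {X : ℕ → Ω → ℝ} {lam : ℝ}

/-- The rounded function takes finitely many values, so the exponential of the sum is a product over
its level sets of powers of `exp (-k / n)`. The generating function of independent counts evaluates
it. -/
lemma lintegral_exp_neg_floor (hX : IsPoissonProcess P X lam) (hlam : 0 ≤ lam) {f : ℝ → ℝ}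
    (hf : Measurable f) {M : ℝ} (hfM : ∀ x, f x ≤ M) {S : Set ℝ} (hS : MeasurableSet S)
    (hSfin : volume S ≠ ∞) (hf0 : ∀ x ∉ S, f x = 0) (n : ℕ) :
    ∫⁻ ω, ENNReal.ofReal (Real.exp (-∑' i, (⌊f (X i ω) * n⌋₊ : ℝ) / n)) ∂P
      = ENNReal.ofReal (Real.exp
          (-(lam * ∫ x in S, (1 - Real.exp (-((⌊f x * n⌋₊ : ℝ) / n)))))) := by
  set N := ⌊M * n⌋₊ + 1 with hN
  have hlt (x : ℝ) : ⌊f x * n⌋₊ < N :=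
    Nat.lt_succ_of_le (Nat.floor_mono (mul_le_mul_of_nonneg_right (hfM x) n.cast_nonneg))
  let B : Fin N → Set ℝ := fun k => levelSet f S n k
  have hB (k : Fin N) : MeasurableSet (B k) := measurableSet_levelSet hf hS n k
  have hBfin (k : Fin N) : volume (B k) ≠ ∞ := measure_ne_top_of_subset inter_subset_left hSfin
  have hdisj : Pairwise (fun k l => Disjoint (B k) (B l)) := by
    intro k l hkl
    rw [Set.disjoint_left]
    rintro x ⟨_, h1⟩ ⟨_, h2⟩
    exact hkl (Fin.ext (h1.symm.trans h2))
  let s : Fin N → ℝ := fun k => Real.exp (-((k : ℕ) / n : ℝ))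
  have key := hX.lintegral_prod_pow_pointCount hlam hB hBfin hdisj (s := s)
    (fun k => (Real.exp_pos _).le)
  have hleft : ∫⁻ ω, ENNReal.ofReal (Real.exp (-∑' i, (⌊f (X i ω) * n⌋₊ : ℝ) / n)) ∂P
      = ∫⁻ ω, ∏ k, ENNReal.ofReal (s k ^ (pointCount X (B k) ω).toNat) ∂P := by
    refine lintegral_congr_ae ?_
    filter_upwards [hX.ae_pointCount_ne_top hS hSfin] with ω hω
    have hI : {i | X i ω ∈ S}.Finite := encard_ne_top_iff.1 hω
    set I := hI.toFinset with hIdef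
    have hsum : ∑' i, (⌊f (X i ω) * n⌋₊ : ℝ) / n = ∑ i ∈ I, (⌊f (X i ω) * n⌋₊ : ℝ) / n := by
      refine tsum_eq_sum fun i hi => ?_
      rw [hf0 _ (by simpa [hIdef] using hi)]
      simp
    have hcount (k : Fin N) : (pointCount X (B k) ω).toNat
        = (I.filter fun i => (⟨⌊f (X i ω) * n⌋₊, hlt _⟩ : Fin N) = k).card := by
      rw [pointCount, ← ncard_def, ← ncard_coe_finset]
      congr 1
      ext i
      simp [hIdef, B, levelSet, Fin.ext_iff]
    rw [← ENNReal.ofReal_prod_of_nonneg (fun k _ => pow_nonneg (Real.exp_pos _).le _), hsum]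
    congr 1
    rw [← Finset.sum_neg_distrib, Real.exp_sum]
    have := Finset.prod_fiberwise' I (fun i => (⟨⌊f (X i ω) * n⌋₊, hlt _⟩ : Fin N)) s
    rw [show ∏ i ∈ I, Real.exp (-((⌊f (X i ω) * n⌋₊ : ℝ) / n))
      = ∏ i ∈ I, s ⟨⌊f (X i ω) * n⌋₊, hlt _⟩ from rfl, ← this]
    refine Finset.prod_congr rfl fun k _ => ?_
    rw [Finset.prod_const, hcount]
  have hright : ∫ x in S, (1 - Real.exp (-((⌊f x * n⌋₊ : ℝ) / n)))
      = ∑ k, (1 - s k) * volume.real (B k) := by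
    have hpt (x : ℝ) : S.indicator (fun x => 1 - Real.exp (-((⌊f x * n⌋₊ : ℝ) / n))) x
        = ∑ k, (B k).indicator (fun _ => 1 - s k) x := by
      by_cases hx : x ∈ S
      · rw [indicator_of_mem hx, Finset.sum_eq_single (⟨⌊f x * n⌋₊, hlt x⟩ : Fin N)]
        · rw [indicator_of_mem (show x ∈ B (⟨⌊f x * n⌋₊, hlt x⟩ : Fin N) from ⟨hx, rfl⟩)]
        · intro k _ hk
          exact indicator_of_notMem (fun h => hk (Fin.ext h.2.symm)) _
        · simp
      · rw [indicator_of_notMem hx]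
        exact (Finset.sum_eq_zero fun k _ => indicator_of_notMem (fun h => hx h.1) _).symm
    rw [← integral_indicator hS]
    simp_rw [hpt]
    rw [integral_finsetSum]
    · refine Finset.sum_congr rfl fun k _ => ?_
      rw [integral_indicator_const _ (hB k), smul_eq_mul, mul_comm]
    · exact fun k _ => (integrable_indicator_iff (hB k)).2 (integrableOn_const (hBfin k))
  rw [hleft, key, hright]

/-- The Laplace functional of a Poisson process. -/
theorem lintegral_exp_neg_tsum (hX : IsPoissonProcess P X lam) (hlam : 0 ≤ lam) {f : ℝ → ℝ}
    (hf : Measurable f) (hfnn : ∀ x, 0 ≤ f x) {M : ℝ} (hfM : ∀ x, f x ≤ M) {S : Set ℝ}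
    (hS : MeasurableSet S) (hSfin : volume S ≠ ∞) (hf0 : ∀ x ∉ S, f x = 0) :
    ∫⁻ ω, ENNReal.ofReal (Real.exp (-∑' i, f (X i ω))) ∂P
      = ENNReal.ofReal (Real.exp (-(lam * ∫ x in S, (1 - Real.exp (-f x))))) := by
  have hfloor (n : ℕ) : Measurable fun x => (⌊f x * n⌋₊ : ℝ) / n :=
    (measurable_from_nat.comp (Nat.measurable_floor.comp (hf.mul_const _))).div_const _
  have hleft : Tendsto
      (fun n : ℕ => ∫⁻ ω, ENNReal.ofReal (Real.exp (-∑' i, (⌊f (X i ω) * n⌋₊ : ℝ) / n)) ∂P) atTop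
      (𝓝 (∫⁻ ω, ENNReal.ofReal (Real.exp (-∑' i, f (X i ω))) ∂P)) := by
    -- Almost surely only finitely many points lie in `S`, so the sums are finite and converge
    -- termwise; the exponentials are bounded by one.
    refine tendsto_lintegral_filter_of_dominated_convergence (fun _ => 1) (.of_forall fun n => ?_)
      (.of_forall fun n => .of_forall fun ω => ?_) (by simp) ?_
    · refine ENNReal.measurable_ofReal.comp (Real.measurable_exp.comp (Measurable.neg ?_))
      exact Measurable.tsum fun i => (hfloor n).comp (hX.measurable i)
    · rw [ENNReal.ofReal_le_one, Real.exp_le_one_iff, neg_nonpos]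
      exact tsum_nonneg fun i => by positivity
    · filter_upwards [hX.ae_pointCount_ne_top hS hSfin] with ω hω
      have hI : {i | X i ω ∈ S}.Finite := encard_ne_top_iff.1 hω
      have hsum (n : ℕ) : ∑' i, (⌊f (X i ω) * n⌋₊ : ℝ) / n
          = ∑ i ∈ hI.toFinset, (⌊f (X i ω) * n⌋₊ : ℝ) / n := by
        refine tsum_eq_sum fun i hi => ?_
        rw [hf0 _ (by simpa using hi)]
        simp
      have hsum' : ∑' i, f (X i ω) = ∑ i ∈ hI.toFinset, f (X i ω) :=
        tsum_eq_sum fun i hi => hf0 _ (by simpa using hi)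
      simp_rw [hsum, hsum']
      refine ENNReal.tendsto_ofReal ((Real.continuous_exp.tendsto _).comp (Tendsto.neg ?_))
      exact tendsto_finsetSum _ fun i _ => tendsto_floor_mul_div (hfnn _)
  have hright : Tendsto (fun n : ℕ => ENNReal.ofReal (Real.exp
      (-(lam * ∫ x in S, (1 - Real.exp (-((⌊f x * n⌋₊ : ℝ) / n))))))) atTop
      (𝓝 (ENNReal.ofReal (Real.exp (-(lam * ∫ x in S, (1 - Real.exp (-f x))))))) := by
    refine ENNReal.tendsto_ofReal ((Real.continuous_exp.tendsto _).comp
      (Tendsto.neg (Tendsto.const_mul _ ?_)))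
    refine tendsto_integral_filter_of_dominated_convergence (fun _ => 1) (.of_forall fun n => ?_)
      (.of_forall fun n => .of_forall fun x => ?_) (integrableOn_const hSfin)
      (.of_forall fun x => ?_)
    · exact (measurable_const.sub (Real.measurable_exp.comp (hfloor n).neg)).aestronglyMeasurable
    · have h0 : 0 ≤ (⌊f x * n⌋₊ : ℝ) / n := by positivity
      have h1 : Real.exp (-((⌊f x * n⌋₊ : ℝ) / n)) ≤ 1 := Real.exp_le_one_iff.2 (by linarith)
      rw [Real.norm_eq_abs, abs_of_nonneg (by linarith)]
      linarith [Real.exp_pos (-((⌊f x * n⌋₊ : ℝ) / n))]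
    · exact tendsto_const_nhds.sub ((Real.continuous_exp.tendsto _).comp
        (tendsto_floor_mul_div (hfnn x)).neg)
  refine tendsto_nhds_unique hleft (hright.congr fun n => ?_)
  exact (hX.lintegral_exp_neg_floor hlam hf hfM hS hSfin hf0 n).symm

end IsPoissonProcess

/-! ### Void probability of a Matérn cluster process. -/

/-- The fraction of the platoon of a parent at `x` that lies in `[p, q]`. -/
noncomputable def coverage (a p q x : ℝ) : ℝ :=
  max 0 (min a (q - x) - max (-a) (p - x)) / (2 * a)

lemma measurable_coverage (a p q : ℝ) : Measurable (coverage a p q) := by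
  unfold coverage; fun_prop

lemma coverage_nonneg {a : ℝ} (ha : 0 < a) (p q x : ℝ) : 0 ≤ coverage a p q x :=
  div_nonneg (le_max_left _ _) (by positivity)

lemma coverage_le_one {a : ℝ} (ha : 0 < a) (p q x : ℝ) : coverage a p q x ≤ 1 := by
  rw [coverage, div_le_one (by positivity)]
  refine max_le (by positivity) ?_
  linarith [min_le_left a (q - x), le_max_left (-a) (p - x)]

lemma coverage_eq_zero {a p q x : ℝ} (hx : x ∉ Icc (p - a) (q + a)) : coverage a p q x = 0 := by
  have : min a (q - x) - max (-a) (p - x) ≤ 0 := by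
    rw [mem_Icc, not_and_or, not_le, not_le] at hx
    rcases hx with h | h
    · linarith [min_le_left a (q - x), le_max_right (-a) (p - x)]
    · linarith [min_le_right a (q - x), le_max_left (-a) (p - x)]
  rw [coverage, max_eq_left this, zero_div]

lemma cond_Icc_apply {a : ℝ} (ha : 0 < a) (p q x : ℝ) :
    cond volume (Icc (-a) a) {u | x + u ∈ Icc p q} = ENNReal.ofReal (coverage a p q x) := by
  have hset : {u | x + u ∈ Icc p q} = Icc (p - x) (q - x) := by
    ext u
    simp only [mem_ofPred_eq, mem_Icc]
    constructor <;> rintro ⟨h1, h2⟩ <;> constructor <;> linarith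
  rw [cond_apply measurableSet_Icc, hset, Icc_inter_Icc, Real.volume_Icc, Real.volume_Icc,
    ← ENNReal.ofReal_inv_of_pos (by linarith), ← ENNReal.ofReal_mul (inv_nonneg.2 (by linarith)),
    coverage, div_eq_inv_mul, sub_neg_eq_add, ← two_mul]
  rcases le_total 0 (min a (q - x) - max (-a) (p - x)) with h | h
  · rw [max_eq_right h]
  · rw [max_eq_left h, mul_zero, ENNReal.ofReal_zero, ENNReal.ofReal_eq_zero]
    exact mul_nonpos_of_nonneg_of_nonpos (by positivity) h

namespace IsMaternCluster

variable {Ω : Type*} [MeasurableSpace Ω] {P : Measure Ω} [IsProbabilityMeasure P]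
  {X : ℕ → Ω → ℝ} {K : ℕ → Ω → ℕ} {U : ℕ → ℕ → Ω → ℝ} {lamP m a : ℝ}

omit [IsProbabilityMeasure P] in
lemma measure_displacement_notMem (h : IsMaternCluster P X K U lamP m a) (ha : 0 < a)
    (i j : ℕ) (p q x : ℝ) :
    P (U i j ⁻¹' {u | x + u ∉ Icc p q}) = ENNReal.ofReal (1 - coverage a p q x) := by
  have hm : MeasurableSet {u : ℝ | x + u ∈ Icc p q} :=
    (measurable_const_add x) measurableSet_Icc
  have : IsProbabilityMeasure (cond (volume : Measure ℝ) (Icc (-a) a)) :=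
    cond_isProbabilityMeasure_of_finite (by simp [ha]) (by simp)
  change P (U i j ⁻¹' {u | x + u ∈ Icc p q}ᶜ) = _
  rw [← Measure.map_apply (h.measurable_displacement i j) hm.compl,
    (h.displacement_law i j).map_eq, prob_compl_eq_one_sub hm, cond_Icc_apply ha, ← ENNReal.ofReal_one,
    ENNReal.ofReal_sub _ (coverage_nonneg ha p q x)]

omit [IsProbabilityMeasure P] in
lemma measure_daughters_notMem_of_number (h : IsMaternCluster P X K U lamP m a) (ha : 0 < a)
    (p q : ℝ) (x : ℕ → ℝ) (k : ℕ → ℕ) (N : ℕ) :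
    P {ω | ∀ i < N, ∀ j < k i, x i + U i j ω ∉ Icc p q}
      = ∏ i ∈ Finset.range N, ENNReal.ofReal ((1 - coverage a p q (x i)) ^ k i) := by
  -- Reindexing by a sigma type lets the finite family `j < k i`, whose size varies with `i`, be
  -- split into an iterated product.
  have hind := h.displacement_indep.precomp (g := fun s : (_ : ℕ) × ℕ => (s.1, s.2))
    (fun s t hst => by
      rcases s with ⟨s1, s2⟩
      rcases t with ⟨t1, t2⟩
      simpa using hst)
  have := hind.measure_inter_preimage_eq_mul
    ((Finset.range N).sigma fun i => Finset.range (k i))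
    (sets := fun s => {u | x s.1 + u ∉ Icc p q})
    (fun s _ => ((measurable_const_add (x s.1)) measurableSet_Icc).compl)
  rw [Finset.prod_sigma] at this
  convert this using 1
  · congr 1
    ext ω
    simp only [mem_ofPred_eq, mem_iInter, Finset.mem_sigma, Finset.mem_range, Sigma.forall,
      and_imp, mem_preimage]
    exact ⟨fun h i j hi hj => h i hi j hj, fun h i hi j hj => h i j hi hj⟩
  · refine Finset.prod_congr rfl fun i _ => ?_
    rw [ENNReal.ofReal_pow (sub_nonneg.2 (coverage_le_one ha _ _ _))]
    have hj (j : ℕ) := h.measure_displacement_notMem ha i j p q (x i)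
    rw [Finset.prod_congr rfl fun j _ => hj j, Finset.prod_const, Finset.card_range]

/-- Conditioning on the numbers leaves a product of powers `(1 - coverage) ^ K i`; the Poisson
generating function at `s = 1 - coverage` gives `exp (-m * coverage)` for each parent. -/
lemma measure_daughters_notMem_of_lt (h : IsMaternCluster P X K U lamP m a) (hm : 0 < m)
    (ha : 0 < a) (p q : ℝ) (x : ℕ → ℝ) (N : ℕ) :
    P {ω | ∀ i < N, ∀ j < K i ω, x i + U i j ω ∉ Icc p q}
      = ENNReal.ofReal (Real.exp (-∑ i ∈ Finset.range N, m * coverage a p q (x i))) := by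
  have hK : Measurable fun ω i => K i ω := measurable_pi_lambda _ h.measurable_number
  have hU : Measurable fun ω i j => U i j ω :=
    measurable_pi_lambda _ fun i => measurable_pi_lambda _ fun j => h.measurable_displacement i j
  have hS : MeasurableSet {s : (ℕ → ℕ) × (ℕ → ℕ → ℝ) |
      ∀ i < N, ∀ j < s.1 i, x i + s.2 i j ∉ Icc p q} := by
    simp only [ofPred_forall]
    refine MeasurableSet.iInter fun i => MeasurableSet.iInter fun _ =>
      MeasurableSet.iInter fun j => ?_
    have h1 : MeasurableSet {s : (ℕ → ℕ) × (ℕ → ℕ → ℝ) | j < s.1 i} :=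
      measurableSet_lt measurable_const (by fun_prop)
    have h2 : MeasurableSet {s : (ℕ → ℕ) × (ℕ → ℕ → ℝ) | x i + s.2 i j ∈ Icc p q} :=
      (show Measurable fun s : (ℕ → ℕ) × (ℕ → ℕ → ℝ) => x i + s.2 i j by fun_prop)
        measurableSet_Icc
    convert h1.compl.union h2.compl using 1
    ext s
    simp only [mem_ofPred_eq, mem_union, mem_compl_iff]
    tauto
  refine (measure_prodMk_of_indepFun hK hU h.number_indep_displacement hS).trans ?_
  have hinner (ω : Ω) := h.measure_daughters_notMem_of_number ha p q x (fun i => K i ω) N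
  simp only [mem_ofPred_eq]
  simp_rw [hinner]
  have hind := h.number_indep.comp
    (fun i (k : ℕ) => ENNReal.ofReal ((1 - coverage a p q (x i)) ^ k)) (fun _ => .of_discrete)
  refine (lintegral_prod_eq_prod_lintegral_of_indepFun (Finset.range N) _ hind
    (fun i => Measurable.of_discrete.comp (h.measurable_number i))).trans ?_
  have hone (i : ℕ) : ∫⁻ ω, ((fun k : ℕ => ENNReal.ofReal ((1 - coverage a p q (x i)) ^ k)) ∘ K i) ω
      ∂P = ENNReal.ofReal (Real.exp (-(m * coverage a p q (x i)))) := by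
    have := lintegral_map (μ := P) (f := fun k : ℕ =>
      ENNReal.ofReal ((1 - coverage a p q (x i)) ^ k)) .of_discrete (h.measurable_number i)
    simp only [Function.comp_apply]
    rw [← this, (h.number_law i).map_eq,
      lintegral_pow_poissonMeasure _ (sub_nonneg.2 (coverage_le_one ha _ _ _)),
      Real.coe_toNNReal _ hm.le]
    congr 2; ring
  rw [Finset.prod_congr rfl fun i _ => hone i,
    ← ENNReal.ofReal_prod_of_nonneg (fun _ _ => (Real.exp_pos _).le), ← Real.exp_sum,
    Finset.sum_neg_distrib]

/-- The void probability of a cluster process with given parents. -/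
lemma measure_daughters_notMem (h : IsMaternCluster P X K U lamP m a) (hm : 0 < m)
    (ha : 0 < a) (p q : ℝ) {x : ℕ → ℝ} (hx : Summable fun i => m * coverage a p q (x i)) :
    P {ω | ∀ i, ∀ j < K i ω, x i + U i j ω ∉ Icc p q}
      = ENNReal.ofReal (Real.exp (-∑' i, m * coverage a p q (x i))) := by
  -- The formula for the first `N` parents passes to all of them by continuity from above.
  let A : ℕ → Set Ω := fun N => {ω | ∀ i < N, ∀ j < K i ω, x i + U i j ω ∉ Icc p q}
  have hA (N : ℕ) : MeasurableSet (A N) := by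
    simp only [A, ofPred_forall]
    refine MeasurableSet.iInter fun i => MeasurableSet.iInter fun _ =>
      MeasurableSet.iInter fun j => ?_
    have h1 : MeasurableSet {ω | j < K i ω} :=
      measurableSet_lt measurable_const (h.measurable_number i)
    have h2 : MeasurableSet {ω | x i + U i j ω ∈ Icc p q} :=
      ((h.measurable_displacement i j).const_add (x i)) measurableSet_Icc
    convert h1.compl.union h2.compl using 1
    ext s
    simp only [mem_ofPred_eq, mem_union, mem_compl_iff]
    tauto
  have hanti : Antitone A := fun N N' hN ω hω i hi => hω i (hi.trans_le hN)
  have hinter : {ω | ∀ i, ∀ j < K i ω, x i + U i j ω ∉ Icc p q} = ⋂ N, A N := by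
    ext ω
    simp only [mem_ofPred_eq, mem_iInter, A]
    exact ⟨fun h N i _ => h i, fun h i => h (i + 1) i i.lt_succ_self⟩
  have hlim := tendsto_measure_iInter_atTop (μ := P) (fun N => (hA N).nullMeasurableSet) hanti
    ⟨0, measure_ne_top _ _⟩
  rw [← hinter] at hlim
  refine tendsto_nhds_unique hlim ?_
  have hval (N : ℕ) := h.measure_daughters_notMem_of_lt hm ha p q x N
  simp only [Function.comp_def, A, hval]
  exact ENNReal.tendsto_ofReal ((Real.continuous_exp.tendsto _).comp
    hx.hasSum.tendsto_sum_nat.neg)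

/-- The void probability of a Matérn cluster process, as an integral over the parents. -/
theorem measure_void (h : IsMaternCluster P X K U lamP m a) (hlam : 0 < lamP) (hm : 0 < m)
    (ha : 0 < a) (p q : ℝ) :
    P {ω | clusterPoints X K U ω ∩ Icc p q = ∅} = ENNReal.ofReal (Real.exp
      (-(lamP * ∫ x in Icc (p - a) (q + a), (1 - Real.exp (-(m * coverage a p q x)))))) := by
  have hX : Measurable fun ω i => X i ω := measurable_pi_lambda _ h.parents.measurable
  have hK : Measurable fun ω i => K i ω := measurable_pi_lambda _ h.measurable_number
  have hU : Measurable fun ω i j => U i j ω :=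
    measurable_pi_lambda _ fun i => measurable_pi_lambda _ fun j => h.measurable_displacement i j
  have hS : MeasurableSet {s : (ℕ → ℝ) × (ℕ → ℕ) × (ℕ → ℕ → ℝ) |
      ∀ i, ∀ j < s.2.1 i, s.1 i + s.2.2 i j ∉ Icc p q} := by
    simp only [ofPred_forall]
    refine MeasurableSet.iInter fun i => MeasurableSet.iInter fun j => ?_
    have h1 : MeasurableSet {s : (ℕ → ℝ) × (ℕ → ℕ) × (ℕ → ℕ → ℝ) | j < s.2.1 i} :=
      measurableSet_lt measurable_const (by fun_prop)
    have h2 : MeasurableSet {s : (ℕ → ℝ) × (ℕ → ℕ) × (ℕ → ℕ → ℝ) |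
        s.1 i + s.2.2 i j ∈ Icc p q} :=
      (show Measurable fun s : (ℕ → ℝ) × (ℕ → ℕ) × (ℕ → ℕ → ℝ) => s.1 i + s.2.2 i j by fun_prop)
        measurableSet_Icc
    convert h1.compl.union h2.compl using 1
    ext s
    simp only [mem_ofPred_eq, mem_union, mem_compl_iff]
    tauto
  have hset : {ω | clusterPoints X K U ω ∩ Icc p q = ∅}
      = {ω | ((fun i => X i ω), (fun i => K i ω), (fun i j => U i j ω)) ∈
        {s : (ℕ → ℝ) × (ℕ → ℕ) × (ℕ → ℕ → ℝ) |
          ∀ i, ∀ j < s.2.1 i, s.1 i + s.2.2 i j ∉ Icc p q}} := by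
    ext ω
    simp only [mem_ofPred_eq, Set.eq_empty_iff_forall_notMem]
    constructor
    · intro h i j hj hmem
      exact h _ ⟨⟨i, j, hj, rfl⟩, hmem⟩
    · rintro h y ⟨⟨i, j, hj, rfl⟩, hmem⟩
      exact h i j hj hmem
  have hSm : MeasurableSet (Icc (p - a) (q + a)) := measurableSet_Icc
  have hSfin : volume (Icc (p - a) (q + a)) ≠ ∞ := by simp
  -- Conditioning on the parents leaves `exp (-∑ f (X i))` with `f = m * coverage`, which is bounded
  -- and vanishes outside `[p - a, q + a]`, as the Laplace functional requires.
  rw [hset, measure_prodMk_of_indepFun hX (hK.prodMk hU) h.parents_indep_daughters hS,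
    ← h.parents.lintegral_exp_neg_tsum hlam.le (f := fun x => m * coverage a p q x)
      ((measurable_coverage a p q).const_mul m)
      (fun x => mul_nonneg hm.le (coverage_nonneg ha p q x)) (M := m)
      (fun x => mul_le_of_le_one_right hm.le (coverage_le_one ha p q x)) hSm hSfin
      (fun x hx => by rw [coverage_eq_zero hx, mul_zero])]
  refine lintegral_congr_ae ?_
  filter_upwards [h.parents.ae_pointCount_ne_top hSm hSfin] with ω hω
  have hI : {i | X i ω ∈ Icc (p - a) (q + a)}.Finite := encard_ne_top_iff.1 hω
  refine h.measure_daughters_notMem hm ha p q (x := fun i => X i ω) ?_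
  refine summable_of_ne_finset_zero (s := hI.toFinset) fun i hi => ?_
  rw [coverage_eq_zero (by simpa using hi), mul_zero]

end IsMaternCluster

/-! ### Evaluation of the integral over the parents. -/

section ClusterIntegral

lemma coverage_add_center {a t : ℝ} (c y : ℝ) :
    coverage a (c - t) (c + t) (c + y) = max 0 (min (2 * min t a) (t + a - |y|)) / (2 * a) := by
  unfold coverage
  congr 2
  rcases abs_cases y with ⟨h, h'⟩ | ⟨h, h'⟩ <;> rw [h] <;> simp only [min_def, max_def] <;>
    split_ifs <;> linarith

lemma integral_one_sub_exp {k : ℝ} (hk : k ≠ 0) (d e : ℝ) :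
    ∫ y in d..e, (1 - Real.exp (-(k * (e - y)))) = e - d - (1 - Real.exp (-(k * (e - d)))) / k := by
  have hderiv (y : ℝ) : HasDerivAt (fun y => y - Real.exp (-(k * (e - y))) / k)
      (1 - Real.exp (-(k * (e - y)))) y := by
    have h1 : HasDerivAt (fun y => -(k * (e - y))) k y := by
      have := (((hasDerivAt_id y).const_sub e).const_mul k).neg
      rw [show -(k * -1) = k by ring] at this
      exact this
    have := (hasDerivAt_id y).sub (h1.exp.div_const k)
    rwa [mul_div_cancel_right₀ _ hk] at this
  rw [intervalIntegral.integral_eq_sub_of_hasDerivAt (fun y _ => hderiv y)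
    (Continuous.intervalIntegrable (by fun_prop) _ _)]
  simp only [sub_self, mul_zero, neg_zero, Real.exp_zero]
  ring

/-- The overlap of `[c - t, c + t]` with a platoon centred at distance `y` from `c` is constant,
equal to `2 * min t a`, up to `y = |t - a|`, and then decreases linearly to zero at `y = t + a`. The
plateau gives the `|t - a|` term, the slope gives the quotient, and symmetry the factor 2. -/
lemma integral_one_sub_exp_coverage {m a t : ℝ} (hm : 0 < m) (ha : 0 < a) (ht : 0 ≤ t) (c : ℝ) :
    ∫ x in Icc (c - t - a) (c + t + a), (1 - Real.exp (-(m * coverage a (c - t) (c + t) x)))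
      = 2 * (t + a - |t - a| * Real.exp (-(m * (min t a / a)))
          - (1 - Real.exp (-(m * (min t a / a)))) / (m / (2 * a))) := by
  set d := |t - a| with hd
  have hmin : t + a - d = 2 * min t a := by
    rcases le_total t a with h | h
    · rw [hd, min_eq_left h, abs_of_nonpos (by linarith)]; ring
    · rw [hd, min_eq_right h, abs_of_nonneg (by linarith)]; ring
  have hmin0 : 0 ≤ min t a := le_min ht ha.le
  have hd0 : 0 ≤ d := abs_nonneg _
  let H : ℝ → ℝ := fun y =>
    1 - Real.exp (-(m * (max 0 (min (2 * min t a) (t + a - y)) / (2 * a))))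
  have hHcont : Continuous H := by fun_prop
  -- The integrand vanishes off the window, so the integral extends to the line, where it can be
  -- recentred at `c` and folded by `|y|`.
  rw [setIntegral_eq_integral_of_forall_compl_eq_zero (fun x hx => by
    rw [coverage_eq_zero hx]; simp)]
  rw [← integral_add_left_eq_self _ c]
  simp_rw [coverage_add_center]
  rw [integral_comp_abs (f := H)]
  congr 1
  have hzero : ∀ y ∈ Ioi 0 \ Ioc 0 (t + a), H y = 0 := by
    rintro y ⟨h1, h2⟩
    have hy : t + a < y := by
      by_contra! h
      exact h2 ⟨h1, h⟩
    simp only [H]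
    rw [max_eq_left ((min_le_right _ _).trans (by linarith))]
    simp
  rw [setIntegral_eq_of_subset_of_forall_sdiff_eq_zero measurableSet_Ioi Ioc_subset_Ioi_self hzero,
    ← intervalIntegral.integral_of_le (by linarith),
    ← intervalIntegral.integral_add_adjacent_intervals (b := d)
      (hHcont.intervalIntegrable _ _) (hHcont.intervalIntegrable _ _)]
  have h1 : ∫ y in (0 : ℝ)..d, H y = d * (1 - Real.exp (-(m * (min t a / a)))) := by
    rw [intervalIntegral.integral_congr (g := fun _ => 1 - Real.exp (-(m * (min t a / a))))]
    · rw [intervalIntegral.integral_const, sub_zero, smul_eq_mul]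
    · intro y hy
      rw [uIcc_of_le hd0] at hy
      simp only [H]
      rw [min_eq_left (by linarith [hy.2]), max_eq_right (by linarith),
        mul_div_mul_left _ _ (two_ne_zero)]
  have h2 : ∫ y in d..(t + a), H y = 2 * min t a
      - (1 - Real.exp (-(m * (min t a / a)))) / (m / (2 * a)) := by
    rw [intervalIntegral.integral_congr
      (g := fun y => 1 - Real.exp (-(m / (2 * a) * (t + a - y))))]
    · rw [integral_one_sub_exp (by positivity), hmin]
      congr 4
      field_simp
    · intro y hy
      rw [uIcc_of_le (by linarith)] at hy
      simp only [H]
      rw [min_eq_right (by linarith [hy.1]), max_eq_right (by linarith [hy.2])]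
      congr 3
      field_simp
  rw [h1, h2, ← hmin]
  ring

end ClusterIntegral

lemma measurable_g (lamP m a s : ℝ) : Measurable (g lamP m a s) := by
  unfold g betaBar; fun_prop

/-- The void probability of a Matérn cluster process. -/
theorem IsMaternCluster.measure_void_eq_exp_g {Ω : Type*} [MeasurableSpace Ω] {P : Measure Ω}
    [IsProbabilityMeasure P] {X : ℕ → Ω → ℝ} {K : ℕ → Ω → ℕ} {U : ℕ → ℕ → Ω → ℝ} {lamP m a : ℝ}
    (h : IsMaternCluster P X K U lamP m a) (hlam : 0 < lamP) (hm : 0 < m) (ha : 0 < a)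
    {p q : ℝ} (hpq : p ≤ q) :
    P {ω | clusterPoints X K U ω ∩ Icc p q = ∅}
      = ENNReal.ofReal (Real.exp (g lamP m a 0 ((q - p) / 2))) := by
  rw [h.measure_void hlam hm ha]
  have := integral_one_sub_exp_coverage hm ha (t := (q - p) / 2) (by linarith) ((p + q) / 2)
  rw [show (p + q) / 2 - (q - p) / 2 = p by ring, show (p + q) / 2 + (q - p) / 2 = q by ring] at this
  rw [this, g, betaBar, mul_div_mul_left _ _ (two_ne_zero (α := ℝ))]
  set E := Real.exp (-(m * (min ((q - p) / 2) a / a))) with hE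
  rw [show m * (min ((q - p) / 2) a / a) * (0 - 1) = -(m * (min ((q - p) / 2) a / a)) by ring,
    show m * (0 - 1) * (min ((q - p) / 2) a / a) = -(m * (min ((q - p) / 2) a / a)) by ring, ← hE]
  congr 2
  field_simp
  ring

/-! ### The two traffic models and the final formulas. -/

/-- Platooned vehicles are a stationary traffic. -/
lemma IsMaternCluster.isStationaryTraffic {Ω : Type*} [MeasurableSpace Ω] {P : Measure Ω}
    [IsProbabilityMeasure P] {X : ℕ → Ω → ℝ} {K : ℕ → Ω → ℕ} {U : ℕ → ℕ → Ω → ℝ} {lamP m a : ℝ}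
    (h : IsMaternCluster P X K U lamP m a) (hlam : 0 < lamP) (hm : 0 < m) (ha : 0 < a) :
    IsStationaryTraffic P
      (fun ω => ((fun i : ℕ => X i ω), (fun i : ℕ => K i ω), (fun i j : ℕ => U i j ω)))
      (fun n : ℕ × ℕ => {e : (ℕ → ℝ) × (ℕ → ℕ) × (ℕ → ℕ → ℝ) | n.2 < e.2.1 n.1})
      (fun n e => e.1 n.1 + e.2.2 n.1 n.2)
      (fun e => {y | ∃ i j : ℕ, j < e.2.1 i ∧ y = e.1 i + e.2.2 i j})
      (fun x => Real.exp (g lamP m a 0 (x / 2))) where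
  measurable := (measurable_pi_lambda _ h.parents.measurable).prodMk
    ((measurable_pi_lambda _ h.measurable_number).prodMk (measurable_pi_lambda _ fun i =>
      measurable_pi_lambda _ fun j => h.measurable_displacement i j))
  measurableSet_domain _ := measurableSet_lt measurable_const (by fun_prop)
  measurable_point _ := by fun_prop
  eq_points e := by ext; simp
  measurable_void := Real.measurable_exp.comp ((measurable_g lamP m a 0).comp (by fun_prop))
  void_nonneg _ := (Real.exp_pos _).le
  measure_void _ _ hpq := h.measure_void_eq_exp_g hlam hm ha hpq

/-- Vehicles without platoons are a stationary traffic. -/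
lemma IsPoissonProcess.isStationaryTraffic {Ω : Type*} [MeasurableSpace Ω] {P : Measure Ω}
    {V : ℕ → Ω → ℝ} {lam : ℝ} (h : IsPoissonProcess P V lam) (hlam : 0 < lam) :
    IsStationaryTraffic P (fun ω (i : ℕ) => V i ω) (fun _ : ℕ => univ) (fun i e => e i)
      (fun e => range e) (fun x => Real.exp (-(lam * x))) where
  measurable := measurable_pi_lambda _ h.measurable
  measurableSet_domain _ := MeasurableSet.univ
  measurable_point _ := by fun_prop
  eq_points e := by ext; simp [eq_comm]
  measurable_void := by fun_prop
  void_nonneg _ := (Real.exp_pos _).le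
  measure_void p q hpq := by
    rw [show q - p = volume.real (Icc p q) by rw [Real.volume_real_Icc_of_le hpq],
      ← h.measure_void hlam.le measurableSet_Icc (by simp)]
    congr 1
    ext ω
    simp [Set.eq_empty_iff_forall_notMem]

/-- The integral is `lamR ^ 2 * Γ(2) / (lamR + lam / 2) ^ 2`, the square of `2γ / (1 + 2γ)` with `γ
= lamR / lam`. -/
lemma integral_void_poisson {lamR lam : ℝ} (hR : 0 < lamR) (hlam : 0 < lam) :
    1 - ∫ s in Ioi 0, Real.exp (-(lam * (s / 2))) * (lamR ^ 2 * s * Real.exp (-(lamR * s)))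
      = (1 + 4 * (lamR / lam)) / (1 + 2 * (lamR / lam)) ^ 2 := by
  have hr : 0 < lamR + lam / 2 := by positivity
  have h := Real.integral_rpow_mul_exp_neg_mul_Ioi (a := 2) (r := lamR + lam / 2) two_pos hr
  have e : ∫ s in Ioi 0, Real.exp (-(lam * (s / 2))) * (lamR ^ 2 * s * Real.exp (-(lamR * s)))
      = lamR ^ 2 * ∫ s in Ioi 0, s ^ ((2 : ℝ) - 1) * Real.exp (-((lamR + lam / 2) * s)) := by
    rw [← integral_const_mul]
    refine setIntegral_congr_fun measurableSet_Ioi fun s _ => ?_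
    rw [show (2 : ℝ) - 1 = 1 by norm_num, Real.rpow_one,
      show -((lamR + lam / 2) * s) = -(lam * (s / 2)) + -(lamR * s) by ring, Real.exp_add]
    ring
  rw [e, h, Real.Gamma_two, Real.rpow_two]
  field_simp
  ring

end Highway

theorem theorem8 {Ω : Type*} [MeasurableSpace Ω] (P : Measure Ω) [IsProbabilityMeasure P]
    (lamR : ℝ) (hlamR : 0 < lamR) (Z : ℕ → Ω → ℝ) (hZ : Highway.IsPoissonProcess P Z lamR) :
    -- platooned traffic
    (∀ (lamP m a : ℝ), 0 < lamP → 0 < m → 0 < a →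
      ∀ (X : ℕ → Ω → ℝ) (K : ℕ → Ω → ℕ) (U : ℕ → ℕ → Ω → ℝ),
        Highway.IsMaternCluster P X K U lamP m a →
        IndepFun (fun ω (i : ℕ) => Z i ω)
          (fun ω => ((fun i : ℕ => X i ω), (fun i : ℕ => K i ω), (fun i j : ℕ => U i j ω))) P →
        Highway.activeProb P (Highway.points Z) (Highway.clusterPoints X K U) =
          1 - Highway.loadPMF P (Highway.points Z) (Highway.clusterPoints X K U) 0 ∧
        IntegrableOn
          (fun t : ℝ => Real.exp (Highway.g lamP m a 0 t) * Highway.fL lamR (2 * t))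
          (Set.Ioi 0) ∧
        Highway.activeProb P (Highway.points Z) (Highway.clusterPoints X K U) =
          1 - 2 * ∫ t in Set.Ioi (0 : ℝ),
          Real.exp (Highway.g lamP m a 0 t) * Highway.fL lamR (2 * t) ∧
        Highway.activeProb P (Highway.points Z) (Highway.clusterPoints X K U) =
          1 - 16 * lamR ^ 2 * ∫ t in Set.Ioi (0 : ℝ),
          t * Real.exp (-4 * lamR * t) * Real.exp (Highway.g lamP m a 0 t) ∧
        Highway.HasDensity P
          (fun ω => Highway.activeRSUs (Highway.points Z ω) (Highway.clusterPoints X K U ω))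
          (Highway.activeProb P (Highway.points Z) (Highway.clusterPoints X K U) * lamR)) ∧
    -- traffic without platoons
    (∀ (lam : ℝ), 0 < lam → ∀ (V : ℕ → Ω → ℝ), Highway.IsPoissonProcess P V lam →
        IndepFun (fun ω (i : ℕ) => Z i ω) (fun ω (i : ℕ) => V i ω) P →
        Highway.activeProb P (Highway.points Z) (Highway.points V) =
          1 - Highway.loadPMF P (Highway.points Z) (Highway.points V) 0 ∧
        Highway.activeProb P (Highway.points Z) (Highway.points V) =
          (1 + 4 * (lamR / lam)) / (1 + 2 * (lamR / lam)) ^ 2 ∧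
        Highway.HasDensity P
          (fun ω => Highway.activeRSUs (Highway.points Z ω) (Highway.points V ω))
          (Highway.activeProb P (Highway.points Z) (Highway.points V) * lamR)) := by
  refine ⟨fun lamP m a hP hm ha X K U h hind => ?_, fun lam hlam V hV hind => ?_⟩
  · have hY := h.isStationaryTraffic hP hm ha
    have hint := hY.integrableOn_void hZ hlamR hind
    have hprob : Highway.activeProb P (Highway.points Z) (Highway.clusterPoints X K U) = _ :=
      hY.activeProb_eq hZ hlamR hind
    -- Substitution `s = 4 * t`: one halving turns the sum of gaps into the cell length, the other
    -- turns that length into the radius in `g`. The Jacobian 4 times the factor `2⁻¹` gives the 2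
    -- before the integral.
    have hscale (t : ℝ) : Real.exp (Highway.g lamP m a 0 (4 * t / 2 / 2))
          * (lamR ^ 2 * (4 * t) * Real.exp (-(lamR * (4 * t))))
        = 2⁻¹ * (Real.exp (Highway.g lamP m a 0 t) * Highway.fL lamR (2 * t)) := by
      rw [Highway.fL, show 4 * t / 2 / 2 = t by ring,
        show -2 * lamR * (2 * t) = -(lamR * (4 * t)) by ring]
      ring
    have hsub := integral_comp_mul_left_Ioi (fun s => Real.exp (Highway.g lamP m a 0 (s / 2 / 2))
      * (lamR ^ 2 * s * Real.exp (-(lamR * s)))) 0 (b := 4) (by norm_num)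
    simp_rw [hscale] at hsub
    rw [mul_zero, integral_const_mul, smul_eq_mul] at hsub
    have hfirst : Highway.activeProb P (Highway.points Z) (Highway.clusterPoints X K U)
        = 1 - 2 * ∫ t in Set.Ioi (0 : ℝ),
          Real.exp (Highway.g lamP m a 0 t) * Highway.fL lamR (2 * t) := by
      rw [hprob]
      linarith
    refine ⟨hY.activeProb_eq_one_sub_loadPMF hZ, ?_, hfirst, ?_,
      hY.hasDensity_activeRSUs hZ hlamR hind⟩
    · have h4 := (integrableOn_Ioi_comp_mul_left_iff (fun s =>
        Real.exp (Highway.g lamP m a 0 (s / 2 / 2))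
          * (lamR ^ 2 * s * Real.exp (-(lamR * s)))) 0 (a := 4) (by norm_num)).2
        (by rwa [mul_zero])
      simp_rw [hscale] at h4
      refine (h4.const_mul 2).congr (.of_forall fun t => ?_)
      simp only
      ring
    · rw [hfirst, ← integral_const_mul, ← integral_const_mul]
      congr 2
      funext t
      rw [Highway.fL, show -2 * lamR * (2 * t) = -4 * lamR * t by ring]
      ring
  · have hY := hV.isStationaryTraffic hlam
    refine ⟨hY.activeProb_eq_one_sub_loadPMF hZ, ?_, hY.hasDensity_activeRSUs hZ hlamR hind⟩
    exact (hY.activeProb_eq hZ hlamR hind).trans (Highway.integral_void_poisson hlamR hlam)
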